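/- Let $\nu$ be a probability measure on the set of probability vectors $(p(-2),p(-1),p(1))$, and let $\omega=(\omega_x)_{x\in\mathbb Z}$ be an i.i.d. environment with law $\mathbb P=\nu^{\otimes\mathbb Z}$. Given $\omega$, let $P_\omega$ be the law of the Markov chain $(X_t)_{t\ge0}$ on $\mathbb Z$ with $X_0=0$ and $P_\omega(X_{t+1}=x+l\mid X_t=x)=\omega_x(l)$ for $l=-2,-1,1$. Put $a_k=\omega_k(-1)/\omega_k(1)$, $b_k=\omega_k(-2)/\omega_k(1)$ and $$A_k=\begin{pmatrix}a_k&b_k&0\\a_k&b_k&1\\a_k&b_k&0\end{pmatrix}.$$ Assume that $\mathbb E\log\omega_0(l)>-\infty$ for $l=-2,-1,1$, and that the top Lyapunov exponent $\gamma_A=\lim_{n\to\infty}\frac1n\mathbb E\log\|A_0A_1\cdots A_{n-1}\|$ is negative. For $n\ge1$ let $T_n=\inf\{t>0:X_t=n\}$, and for $i\in\mathbb Z$ let $\mathbf U_i^n=(U_{i,1}^n,U_{i,2}^n,U_{i,3}^n)$ be the numbers of steps before time $T_n$ from $i$ to $i-1$, from $i$ to $i-2$, and from $i+1$ to $i-1$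 respectively (jumps of type $1,2,3$ at level $i$). The sequence $\mathbf U^n_n=0,\mathbf U^n_{n-1},\mathbf U^n_{n-2},\dots$ is the 3-type branching process in random environment in the path: an individual of type $l$ at level $i+1$ is an excursion, which starts with a type-$l$ jump at level $i+1$ and ends when the walk next reaches $i+1$; its children are the jumps at level $i$ made during the excursion; and one individual of type $1$ immigrates at each of the levels $1,\dots,n$, and none at the levels $\le0$. Then for $\mathbb P$-almost every $\omega$ the following hold. 1. For every $i\in\mathbb Z$ the quenched mean offspring matrix from level $i+1$ to level $i$ is $A_i$: for $l,m\in\{1,2,3\}$, the $P_\omega$-mean number of type-$m$ children of a type-$l$ individual at level $i+1$ (that is, the mean number of type-$m$ jumps at level $i$ before the hitting time of $i+1$, for the walk started at the origin of a type-$l$ jump at level $i+1$ and conditioned to make this jump first) equals the $(l,m)$ entry of $A_i$. 2. For all $n\ge1$, $i\le n-1$ and $u\in\mathbb N^3$ with $P_\omega(\mathbf U_{i+1}^n=u)>0$, $$E_\omega(\mathbf U_i^n\mid\mathbf U_{i+1}^n=u)=\bigl(u+\mathbf 1_{\{i\ge0\}}\,\mathbf e_1\bigr)A_i .$$ In particular,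 for $i<0$, $E_\omega(\mathbf U_i^n\mid\mathbf U_{i+1}^n=\mathbf e_l)$ is the $l$-th row of $A_i$ whenever $P_\omega(\mathbf U_{i+1}^n=\mathbf e_l)>0$. 3. For all $n\ge1$, $$E_\omega T_n=n+\sum_{i=0}^{n-1}\sum_{k=-\infty}^{i}\mathbf e_1A_iA_{i-1}\cdots A_k(2,1,2)^t .$$ Here $\mathbf e_l$ is the $l$-th unit row vector. -/

import Mathlib

open MeasureTheory ProbabilityTheory
open scoped ENNReal Matrix

noncomputable section

namespace RWRE21

/-- The three possible displacements `-2`, `-1`, `1`, indexed by `0`, `1`, `2`. -/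
def jump : Fin 3 → ℤ := ![-2, -1, 1]

/-- A probability vector `(p(-2), p(-1), p(1))` on the displacements. -/
abbrev JumpLaw : Type := stdSimplex ℝ (Fin 3)

/-- An environment `ω = (ω_x)`, `x ∈ ℤ`. -/
abbrev Env : Type := ℤ → JumpLaw

/-- The law `ν^{⊗ℤ}` of an i.i.d. environment. -/
def envLaw (ν : Measure JumpLaw) : Measure Env := Measure.infinitePi (fun _ : ℤ => ν)

/-! ### The quenched walk -/

/-- The law of the next position of the walk when it is at `x`. -/
def stepMeasure (ω : Env) (x : ℤ) : Measure ℤ :=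
  ∑ j : Fin 3, ENNReal.ofReal ((ω x).1 j) • Measure.dirac (x + jump j)

instance (ω : Env) (x : ℤ) : IsProbabilityMeasure (stepMeasure ω x) := by
  constructor
  have h0 : ∀ j ∈ (Finset.univ : Finset (Fin 3)), 0 ≤ (ω x).1 j := fun j _ => (ω x).2.1 j
  have h1 : ∑ j : Fin 3, (ω x).1 j = 1 := (ω x).2.2
  simp only [stepMeasure, Measure.coe_finsetSum, Finset.sum_apply, Measure.smul_apply,
    measure_univ, smul_eq_mul, mul_one]
  rw [← ENNReal.ofReal_sum_of_nonneg h0, h1, ENNReal.ofReal_one]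

/-- The transition kernel on `ℤ` of the walk in the environment `ω`. -/
def stepKernel (ω : Env) : Kernel ℤ ℤ := Kernel.ofFunOfCountable (stepMeasure ω)

instance (ω : Env) : IsMarkovKernel (stepKernel ω) :=
  ⟨fun x => inferInstanceAs (IsProbabilityMeasure (stepMeasure ω x))⟩

/-- The transition kernel from the history up to time `t` to the position at time `t + 1`:
it depends on the history only through the position at time `t`. -/
def histKernel (ω : Env) (t : ℕ) : Kernel (Finset.Iic t → ℤ) ℤ :=
  (stepKernel ω).comap (fun h => h ⟨t, Finset.mem_Iic.2 le_rfl⟩) (measurable_pi_apply _)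

instance (ω : Env) (t : ℕ) : IsMarkovKernel (histKernel ω t) := by
  unfold histKernel; infer_instance

/-- The quenched law, on path space, of the Markov chain started at `x`
in the environment `ω`. -/
def quenched (ω : Env) (x : ℤ) : Measure (ℕ → ℤ) :=
  Kernel.trajMeasure (X := fun _ => ℤ) (Measure.dirac x) (histKernel ω)

/-! ### Hitting times and step counts of a path -/

/-- `T_n = inf {t > 0 : X_t = n}`, equal to `∞` if there is no such `t`. -/
def hit (n : ℤ) (X : ℕ → ℤ) : ℕ∞ := ⨅ (t : ℕ) (_ : 0 < t ∧ X t = n), (t : ℕ∞)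

/-- The number of steps from `x` to `y` strictly before `T_n`. -/
def stepCount (n x y : ℤ) (X : ℕ → ℤ) : ℕ∞ :=
  {k : ℕ | 0 < k ∧ (k : ℕ∞) < hit n X ∧ X (k - 1) = x ∧ X k = y}.encard

/-- The site from which a type-`l` jump at level `i` starts (types `1, 2, 3` are the indices
`0, 1, 2`): a jump of type 1, 2, 3 goes `i → i - 1`, `i → i - 2`, `i + 1 → i - 1`. -/
def jumpFrom (i : ℤ) : Fin 3 → ℤ := ![i, i, i + 1]

/-- The site at which a type-`l` jump at level `i` ends. -/
def jumpTo (i : ℤ) : Fin 3 → ℤ := ![i - 1, i - 2, i - 1]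

/-- The vector `U_i^n = (U_{i,1}^n, U_{i,2}^n, U_{i,3}^n)`. -/
def U (n i : ℤ) (X : ℕ → ℤ) : Fin 3 → ℕ∞ :=
  fun l => stepCount n (jumpFrom i l) (jumpTo i l) X

/-! ### The matrices `A_k` and the top Lyapunov exponent -/

/-- `a_k = ω_k(-1) / ω_k(1)`. -/
def a (ω : Env) (k : ℤ) : ℝ := (ω k).1 1 / (ω k).1 2

/-- `b_k = ω_k(-2) / ω_k(1)`. -/
def b (ω : Env) (k : ℤ) : ℝ := (ω k).1 0 / (ω k).1 2

/-- The matrix `A_k`. -/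
def A (ω : Env) (k : ℤ) : Matrix (Fin 3) (Fin 3) ℝ :=
  !![a ω k, b ω k, 0;
     a ω k, b ω k, 1;
     a ω k, b ω k, 0]

/-- `A_0 A_1 ⋯ A_{n-1}`. -/
def ascProd (ω : Env) (n : ℕ) : Matrix (Fin 3) (Fin 3) ℝ :=
  ((List.range n).map fun j => A ω (j : ℤ)).prod

/-- `A_i A_{i-1} ⋯ A_k`, for `k ≤ i`. -/
def descProd (ω : Env) (i k : ℤ) : Matrix (Fin 3) (Fin 3) ℝ :=
  ((List.range ((i - k).toNat + 1)).map fun j => A ω (i - (j : ℤ))).prod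

/-- The sum of the absolute values of the entries; any other matrix norm gives the same
Lyapunov exponent. -/
def entryNorm (M : Matrix (Fin 3) (Fin 3) ℝ) : ℝ := ∑ i, ∑ j, |M i j|

/-- The top Lyapunov exponent `γ_A = lim (1/n) E log ‖A_0 ⋯ A_{n-1}‖` of the i.i.d. sequence
`(A_k)`. The limit exists by subadditivity under the integrability condition `C1`; it is
written here as an upper limit in the extended reals. -/
def lyapunovA (ν : Measure JumpLaw) : EReal :=
  Filter.limsup
    (fun n : ℕ => (((∫ ω, Real.log (entryNorm (ascProd ω n)) ∂(envLaw ν)) / (n : ℝ) : ℝ) : EReal))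
    Filter.atTop

/-- `E log ω_0(l) > -∞` for `l = -2, -1, 1`. As `log 0` means `-∞` here, this comprises
`ω_0(l) > 0` almost surely. -/
def C1 (ν : Measure JumpLaw) : Prop :=
  ∀ l : Fin 3, (∀ᵐ p ∂ν, 0 < p.1 l) ∧ Integrable (fun p : JumpLaw => Real.log (p.1 l)) ν

/-- The top Lyapunov exponent is negative. -/
def C2 (ν : Measure JumpLaw) : Prop := lyapunovA ν < 0

/-! ### Mean offspring -/

/-- The quenched mean offspring matrix of the branching process in the path, from level `i + 1`
to level `i`. An individual of type `l` at level `i + 1` is an excursion: a type-`l` jump at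
level `i + 1`, followed by the walk until it reaches `i + 1` again. Its children are the
jumps at level `i` of the three types which occur in the excursion. So the `(l, m)` entry is
the mean number of type-`m` jumps at level `i` before the hitting time of `i + 1`, for the
walk started at the origin of a type-`l` jump at level `i + 1` and conditioned to make this
jump as its first step. -/
def meanOffspring (ω : Env) (i : ℤ) : Matrix (Fin 3) (Fin 3) ℝ≥0∞ :=
  Matrix.of fun l m =>
    ∫⁻ X, ((U (i + 1) i X m : ℕ∞) : ℝ≥0∞)
      ∂((quenched ω (jumpFrom (i + 1) l))[|{X : ℕ → ℤ | X 1 = jumpTo (i + 1) l}])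

/-- The immigrant at level `i + 1` (`i < n`), born into the next generation at level `i`:
one individual of type 1 if `i ≥ 0`, none if `i < 0`. -/
def immigrant (i : ℤ) : Fin 3 → ℝ := if 0 ≤ i then Pi.single 0 1 else 0

/-- The event `{U_i^n = u}`. -/
def levelEvent (n i : ℤ) (u : Fin 3 → ℕ) : Set (ℕ → ℤ) :=
  {X | ∀ l, U n i X l = (u l : ℕ∞)}

end RWRE21

end

/-!
The strong law of large numbers, applied to the logarithms of the norms of disjoint blocks of the
product `A_i A_{i-1} ⋯`, shows that a negative Lyapunov exponent makes this product come arbitrarily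
close to zero. The increments of a harmonic function along the jumps at level `k + 1` are `A_k`
times those along the jumps at level `k`; hence a bounded function which is harmonic on a left
half-line is constant there. It follows that the walk reaches every point to its right, and that
what it does above level `i` has the same law for all starting points `x ≤ i + 1`.

Therefore the choice of the jump at a visit to `i` does not influence the jumps at level `i + 1`,
and given these the numbers of steps from `i` to `i - 2`, `i - 1` and `i + 1` are on average in the
ratio `ω_i(-2) : ω_i(-1) : ω_i(1)`. The steps from `i` to `i + 1` alternate with the jumps at level
`i + 1`, so that the latter, together with the immigrant, determine their number. This is the
recursion for the means of the branching process. The weights `2, 1, 2` turn the numbers of jumps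
into the time which they take.
-/

noncomputable section

namespace RWRE21

/-! ### Markov chains on a countable state space -/

section MarkovChain

variable {E : Type*}

/-- The path which starts at `x` and continues with `Y`. -/
def cons (x : E) (Y : ℕ → E) : ℕ → E
  | 0 => x
  | t + 1 => Y t

/-- The path seen from time `1` on. -/
def tail (X : ℕ → E) : ℕ → E := fun t => X (t + 1)

@[simp] lemma cons_zero (x : E) (Y : ℕ → E) : cons x Y 0 = x := rfl

@[simp] lemma cons_succ (x : E) (Y : ℕ → E) (t : ℕ) : cons x Y (t + 1) = Y t := rfl

@[simp] lemma tail_apply (X : ℕ → E) (t : ℕ) : tail X t = X (t + 1) := rfl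

@[simp] lemma tail_cons (x : E) (Y : ℕ → E) : tail (cons x Y) = Y := rfl

/-- The paths which agree with `z` up to time `t`. -/
def cylinder (z : ℕ → E) (t : ℕ) : Set (ℕ → E) := {X | ∀ s ≤ t, X s = z s}

lemma cylinder_zero (z : ℕ → E) : cylinder z 0 = (fun X => X 0) ⁻¹' {z 0} := by
  ext X; simp [cylinder]

lemma cylinder_succ (z : ℕ → E) (t : ℕ) :
    cylinder z (t + 1) = cylinder z t ∩ {X | X (t + 1) = z (t + 1)} := by
  ext X
  simp [cylinder, Nat.le_succ_iff, or_imp, forall_and]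

lemma cylinder_eq_preimage (z : ℕ → E) (t : ℕ) :
    cylinder z t = Preorder.frestrictLe (π := fun _ => E) t ⁻¹' {Preorder.frestrictLe t z} := by
  ext X
  simp [cylinder, funext_iff, Preorder.frestrictLe]

lemma cons_preimage_cylinder_succ (z : ℕ → E) (t : ℕ) :
    cons (z 0) ⁻¹' cylinder z (t + 1) = cylinder (tail z) t := by
  ext Y
  simp only [cylinder, Set.mem_preimage, Set.mem_ofPred_eq, tail_apply]
  exact ⟨fun h s hs => h (s + 1) (by lia), fun h s hs => by
    cases s with
    | zero => rfl
    | succ s => exact h s (by lia)⟩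

variable [MeasurableSpace E]

@[fun_prop] lemma measurable_cons (x : E) : Measurable (cons x) := by
  refine measurable_pi_iff.2 fun t => ?_
  cases t with
  | zero => exact measurable_const
  | succ t => exact measurable_pi_apply t

@[fun_prop] lemma measurable_tail : Measurable (tail : (ℕ → E) → ℕ → E) :=
  measurable_pi_iff.2 fun t => measurable_pi_apply (t + 1)

/-- The law on path space of the Markov chain with transition kernel `κ` started at `x`. -/
def pathLaw (κ : Kernel E E) [IsMarkovKernel κ] (x : E) : Measure (ℕ → E) :=
  Kernel.trajMeasure (X := fun _ => E) (Measure.dirac x) fun t =>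
    κ.comap (fun h : Finset.Iic t → E => h ⟨t, Finset.mem_Iic.2 le_rfl⟩) (measurable_pi_apply _)

variable (κ : Kernel E E) [IsMarkovKernel κ]

instance (x : E) : IsProbabilityMeasure (pathLaw κ x) := by
  unfold pathLaw; infer_instance

lemma pathLaw_map_eval_zero (x : E) : (pathLaw κ x).map (fun X => X 0) = Measure.dirac x := by
  let eval : (Finset.Iic 0 → E) → E := fun h => h ⟨0, Finset.mem_Iic.2 le_rfl⟩
  have hfactor : (fun X : ℕ → E => X 0) = eval ∘ Preorder.frestrictLe (π := fun _ => E) 0 := rfl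
  rw [hfactor, ← Measure.map_map (by fun_prop) (by fun_prop), pathLaw, Kernel.trajMeasure,
    Measure.map_comp _ _ (by fun_prop), Kernel.traj_map_frestrictLe, Kernel.partialTraj_self,
    Measure.id_comp, Measure.map_map (by fun_prop) (by fun_prop)]
  exact Measure.map_id

variable [MeasurableSingletonClass E]

@[measurability] lemma measurableSet_cylinder (z : ℕ → E) (t : ℕ) :
    MeasurableSet (cylinder z t) := by
  rw [cylinder_eq_preimage]
  exact measurableSet_preimage (by fun_prop) (measurableSet_singleton _)

lemma ae_start (x : E) : ∀ᵐ X ∂(pathLaw κ x), X 0 = x := by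
  refine ae_of_ae_map (f := fun X : ℕ → E => X 0) (p := fun y => y = x)
    (measurable_pi_apply 0).aemeasurable ?_
  rw [pathLaw_map_eval_zero, ae_dirac_eq]
  rfl

lemma pathLaw_cylinder_succ (x : E) (z : ℕ → E) (t : ℕ) :
    pathLaw κ x (cylinder z (t + 1)) = pathLaw κ x (cylinder z t) * κ (z t) {z (t + 1)} := by
  have hcyl : cylinder z (t + 1) = (fun X : ℕ → E => (Preorder.frestrictLe (π := fun _ => E) t X,
      X (t + 1))) ⁻¹' ({Preorder.frestrictLe (π := fun _ => E) t z} ×ˢ {z (t + 1)}) := by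
    rw [cylinder_succ, cylinder_eq_preimage]
    rfl
  rw [hcyl, ← Measure.map_apply (by fun_prop)
      ((measurableSet_singleton _).prod (measurableSet_singleton _)), pathLaw,
    ← Kernel.map_frestrictLe_trajMeasure_compProd_eq_map_trajMeasure,
    Measure.compProd_apply_prod (measurableSet_singleton _) (measurableSet_singleton _),
    Measure.restrict_singleton, lintegral_smul_measure, lintegral_dirac,
    Measure.map_apply (by fun_prop) (measurableSet_singleton _), ← cylinder_eq_preimage]
  rfl

open Classical in
lemma pathLaw_cylinder (x : E) (z : ℕ → E) (t : ℕ) :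
    pathLaw κ x (cylinder z t) =
      if z 0 = x then ∏ s ∈ Finset.range t, κ (z s) {z (s + 1)} else 0 := by
  induction t with
  | zero =>
    rw [cylinder_zero, ← Measure.map_apply (by fun_prop) (measurableSet_singleton _),
      pathLaw_map_eval_zero]
    simp [Set.indicator_apply, eq_comm]
  | succ t ih =>
    rw [pathLaw_cylinder_succ, ih, Finset.prod_range_succ]
    split_ifs <;> simp

variable [Countable E]

lemma ext_of_cylinder {μ ν : Measure (ℕ → E)} [IsFiniteMeasure μ]
    (h : ∀ z t, μ (cylinder z t) = ν (cylinder z t)) : μ = ν := by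
  have hIic : ∀ t, ν.map (Preorder.frestrictLe (π := fun _ => E) t)
      = μ.map (Preorder.frestrictLe t) := by
    intro t
    refine Measure.ext_of_singleton fun w => ?_
    let z : ℕ → E := fun s => w ⟨min s t, Finset.mem_Iic.2 (min_le_right s t)⟩
    have hw : w = Preorder.frestrictLe (π := fun _ => E) t z := by
      funext s
      simp [z, Preorder.frestrictLe, Finset.mem_Iic.1 s.2]
    rw [Measure.map_apply (by fun_prop) (measurableSet_singleton _),
      Measure.map_apply (by fun_prop) (measurableSet_singleton _), hw, ← cylinder_eq_preimage, h]
  have hfamily := isProjectiveMeasureFamily_map_restrict (P := μ)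
    (X := fun t (Y : ℕ → E) => Y t) fun t => (measurable_pi_apply t).aemeasurable
  exact IsProjectiveLimit.unique (fun _ => rfl) ((isProjectiveLimit_nat_iff hfamily ν).2 hIic)

theorem pathLaw_eq_sum (x : E) :
    pathLaw κ x = Measure.sum fun y => κ x {y} • (pathLaw κ y).map (cons x) := by
  refine ext_of_cylinder fun z t => ?_
  simp only [Measure.sum_apply _ (measurableSet_cylinder z t), Measure.smul_apply, smul_eq_mul,
    Measure.map_apply (measurable_cons x) (measurableSet_cylinder z t)]
  by_cases hz : z 0 = x
  · subst hz
    cases t with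
    | zero =>
      have hpre : cons (z 0) ⁻¹' cylinder z 0 = Set.univ := by ext Y; simp [cylinder]
      have htotal : ∑' y, κ (z 0) {y} = 1 := by
        rw [← measure_univ (μ := κ (z 0)), ← lintegral_one, lintegral_countable']
        simp only [one_mul]
      simp [hpre, htotal, pathLaw_cylinder]
    | succ t =>
      rw [cons_preimage_cylinder_succ, pathLaw_cylinder, if_pos rfl, Finset.prod_range_succ',
        tsum_eq_single (z 1)]
      · simp [pathLaw_cylinder, mul_comm]
      · intro y hy
        simp [pathLaw_cylinder, hy.symm]
  · have hpre : cons x ⁻¹' cylinder z t = ∅ :=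
      Set.eq_empty_of_forall_notMem fun Y hY => hz (hY 0 t.zero_le).symm
    simp [pathLaw_cylinder, hz, hpre]

theorem lintegral_pathLaw (x : E) {F : (ℕ → E) → ℝ≥0∞} (hF : Measurable F) :
    ∫⁻ X, F X ∂(pathLaw κ x) = ∫⁻ y, ∫⁻ Y, F (cons x Y) ∂(pathLaw κ y) ∂(κ x) := by
  rw [pathLaw_eq_sum, lintegral_sum_measure, lintegral_countable']
  refine tsum_congr fun y => ?_
  rw [lintegral_smul_measure, lintegral_map hF (measurable_cons x), smul_eq_mul, mul_comm]

theorem pathLaw_cond_eq_map_cons (x y : E) (hy : κ x {y} ≠ 0) :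
    (pathLaw κ x)[|{X | X 1 = y}] = (pathLaw κ y).map (cons x) := by
  have hmeas : MeasurableSet {X : ℕ → E | X 1 = y} :=
    measurable_pi_apply (X := fun _ : ℕ => E) 1 (measurableSet_singleton y)
  have hrestrict : (pathLaw κ x).restrict {X | X 1 = y}
      = κ x {y} • (pathLaw κ y).map (cons x) := by
    rw [pathLaw_eq_sum, Measure.restrict_sum _ hmeas]
    ext s hs
    rw [Measure.sum_apply _ hs, tsum_eq_single y]
    · have hone : ∀ᵐ X ∂(pathLaw κ y).map (cons x), X ∈ {X : ℕ → E | X 1 = y} :=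
        (ae_map_iff (by fun_prop) hmeas).2 (ae_start κ y)
      rw [Measure.restrict_smul, Measure.restrict_eq_self_of_ae_mem hone]
    · intro y' hy'
      have hnone : (pathLaw κ y').map (cons x) {X | X 1 = y} = 0 := by
        rw [Measure.map_apply (by fun_prop) hmeas, measure_eq_zero_iff_ae_notMem]
        filter_upwards [ae_start κ y'] with Y hY
        simpa [hY] using hy'
      rw [Measure.restrict_smul, Measure.restrict_eq_zero.2 hnone, smul_zero, Measure.coe_zero,
        Pi.zero_apply]
  have hprob : pathLaw κ x {X | X 1 = y} = κ x {y} := by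
    rw [← Measure.restrict_apply_univ, hrestrict]
    simp [Measure.map_apply (measurable_cons x)]
  rw [ProbabilityTheory.cond, hprob, hrestrict, smul_smul,
    ENNReal.inv_mul_cancel hy (measure_ne_top _ _), one_smul]

end MarkovChain

/-! ### Steps of a path before its first visit to a point -/

section StepCounts

variable {E : Type*}

/-- The path `X` does not visit `n` up to time `s`. -/
def Avoids (n : E) (s : ℕ) (X : ℕ → E) : Prop := ∀ r ≤ s, X r ≠ n

/-- The paths which make a step in `S` at time `s`, having avoided `n` until then. -/
def stepAt (n : E) (S : Set (E × E)) (s : ℕ) : Set (ℕ → E) :=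
  {X | Avoids n s X ∧ (X s, X (s + 1)) ∈ S}

/-- The number of steps in `S` which the path `X` makes before its first visit to `n`. The visit
may be at time `0`, so that nothing is counted for a path which starts at `n`. -/
def stepsBefore (n : E) (S : Set (E × E)) (X : ℕ → E) : ℝ≥0∞ := ∑' s, (stepAt n S s).indicator 1 X

variable {n : E} {S : Set (E × E)} {s : ℕ} {X : ℕ → E}

lemma avoids_zero : Avoids n 0 X ↔ X 0 ≠ n := by simp [Avoids]

lemma avoids_succ : Avoids n (s + 1) X ↔ X 0 ≠ n ∧ Avoids n s (tail X) :=
  ⟨fun h => ⟨h 0 (Nat.zero_le _), fun r hr => h (r + 1) (Nat.succ_le_succ hr)⟩,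
    fun h r hr => match r with
      | 0 => h.1
      | r + 1 => h.2 r (Nat.le_of_succ_le_succ hr)⟩

lemma mem_stepAt_zero : X ∈ stepAt n S 0 ↔ X 0 ≠ n ∧ (X 0, X 1) ∈ S :=
  and_congr_left' avoids_zero

lemma mem_stepAt_succ : X ∈ stepAt n S (s + 1) ↔ X 0 ≠ n ∧ tail X ∈ stepAt n S s :=
  (and_congr_left' avoids_succ).trans and_assoc

lemma stepsBefore_of_start_eq (h : X 0 = n) : stepsBefore n S X = 0 :=
  ENNReal.tsum_eq_zero.2 fun s => Set.indicator_of_notMem (fun hX => hX.1 0 s.zero_le h) _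

lemma stepsBefore_of_start_ne (h : X 0 ≠ n) :
    stepsBefore n S X = S.indicator 1 (X 0, X 1) + stepsBefore n S (tail X) := by
  rw [stepsBefore, tsum_eq_zero_add' ENNReal.summable]
  congr 1
  · exact Set.indicator_eq_indicator (mem_stepAt_zero.trans (and_iff_right h)) rfl
  · exact tsum_congr fun s =>
      Set.indicator_eq_indicator (mem_stepAt_succ.trans (and_iff_right h)) rfl

lemma stepsBefore_cons {x : E} (hx : x ≠ n) (Y : ℕ → E) :
    stepsBefore n S (cons x Y) = S.indicator 1 (x, Y 0) + stepsBefore n S Y :=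
  stepsBefore_of_start_ne hx

variable [MeasurableSpace E] [MeasurableSingletonClass E]

lemma measurableSet_avoids (n : E) (s : ℕ) : MeasurableSet {X : ℕ → E | Avoids n s X} := by
  simp only [Avoids, Set.ofPred_forall]
  exact .iInter fun r => .iInter fun _ =>
    (measurable_pi_apply (X := fun _ : ℕ => E) r (measurableSet_singleton n)).compl

lemma setLIntegral_stepAt_of_start_eq (κ : Kernel E E) [IsMarkovKernel κ] (n : E)
    (S : Set (E × E)) (s : ℕ) (F : (ℕ → E) → ℝ≥0∞) :
    ∫⁻ X in stepAt n S s, F X ∂(pathLaw κ n) = 0 := by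
  refine setLIntegral_measure_zero _ _ (measure_eq_zero_iff_ae_notMem.2 ?_)
  filter_upwards [ae_start κ n] with X hX hmem using hmem.1 0 s.zero_le hX

variable [Countable E]

lemma measurableSet_stepAt (n : E) (S : Set (E × E)) (s : ℕ) : MeasurableSet (stepAt n S s) :=
  (measurableSet_avoids n s).inter
    (measurableSet_preimage (f := fun X : ℕ → E => (X s, X (s + 1))) (by fun_prop) .of_discrete)

@[fun_prop] lemma measurable_stepsBefore (n : E) (S : Set (E × E)) :
    Measurable (stepsBefore n S) :=
  .tsum fun s => measurable_one.indicator (measurableSet_stepAt n S s)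

variable (κ : Kernel E E) [IsMarkovKernel κ]

lemma setLIntegral_stepAt_zero (n x : E) (S : Set (E × E)) {F : (ℕ → E) → ℝ≥0∞}
    (hF : Measurable F) (hx : x ≠ n) :
    ∫⁻ X in stepAt n S 0, F X ∂(pathLaw κ x) =
      ∫⁻ y in {y | (x, y) ∈ S}, ∫⁻ Y, F (cons x Y) ∂(pathLaw κ y) ∂(κ x) := by
  have hmeas := measurableSet_stepAt n S 0
  rw [← lintegral_indicator hmeas, lintegral_pathLaw κ x (hF.indicator hmeas),
    ← lintegral_indicator .of_discrete]
  refine lintegral_congr fun y => ?_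
  have hmem : ∀ᵐ Y ∂(pathLaw κ y), cons x Y ∈ stepAt n S 0 ↔ (x, y) ∈ S := by
    filter_upwards [ae_start κ y] with Y hY
    rw [mem_stepAt_zero, cons_zero, show (1 : ℕ) = 0 + 1 from rfl, cons_succ, hY]
    exact and_iff_right hx
  by_cases hy : (x, y) ∈ S
  · rw [Set.indicator_of_mem (by exact hy)]
    refine lintegral_congr_ae ?_
    filter_upwards [hmem] with Y hY using Set.indicator_of_mem (hY.2 hy) F
  · rw [Set.indicator_of_notMem (by exact hy)]
    refine (lintegral_congr_ae ?_).trans lintegral_zero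
    filter_upwards [hmem] with Y hY using Set.indicator_of_notMem (mt hY.1 hy) F

lemma setLIntegral_stepAt_succ (n x : E) (S : Set (E × E)) (s : ℕ) {F : (ℕ → E) → ℝ≥0∞}
    (hF : Measurable F) (hx : x ≠ n) :
    ∫⁻ X in stepAt n S (s + 1), F X ∂(pathLaw κ x) =
      ∫⁻ y, ∫⁻ Y in stepAt n S s, F (cons x Y) ∂(pathLaw κ y) ∂(κ x) := by
  have hpre : cons x ⁻¹' stepAt n S (s + 1) = stepAt n S s := by
    ext Y
    exact mem_stepAt_succ.trans (and_iff_right hx)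
  have hmeas := measurableSet_stepAt n S (s + 1)
  rw [← lintegral_indicator hmeas, lintegral_pathLaw κ x (hF.indicator hmeas)]
  refine lintegral_congr fun y => ?_
  rw [← lintegral_indicator (measurableSet_stepAt n S s), ← hpre]
  rfl

lemma setLIntegral_stepAt_zero_stepsBefore {ι : Type*} {n p q : E} {S : ι → Set (E × E)}
    (hS : ∀ l y, (p, y) ∉ S l)
    (hlaw : (pathLaw κ q).map (fun X l => stepsBefore n (S l) X) =
      (pathLaw κ p).map (fun X l => stepsBefore n (S l) X))
    {φ : (ι → ℝ≥0∞) → ℝ≥0∞} (hφ : Measurable φ) {x : E} (hx : x ≠ n) :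
    ∫⁻ X in stepAt n {(p, q)} 0, φ (fun l => stepsBefore n (S l) X) ∂(pathLaw κ x) =
      κ p {q} * ∫⁻ X in stepAt n {z | z.1 = p} 0, φ (fun l => stepsBefore n (S l) X)
        ∂(pathLaw κ x) := by
  have hN : Measurable fun X l => stepsBefore n (S l) X := by fun_prop
  have hF : Measurable fun X => φ fun l => stepsBefore n (S l) X := by fun_prop
  rw [setLIntegral_stepAt_zero κ n x _ hF hx, setLIntegral_stepAt_zero κ n x _ hF hx]
  rcases eq_or_ne x p with rfl | hxp
  · have hq : {y | (x, y) ∈ ({(x, q)} : Set (E × E))} = {q} := by ext; simp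
    have huniv : {y : E | (x, y) ∈ {z : E × E | z.1 = x}} = Set.univ := by ext; simp
    rw [hq, huniv, Measure.restrict_univ, ← lintegral_pathLaw κ x hF, lintegral_singleton]
    simp only [stepsBefore_cons hx, Set.indicator_of_notMem (hS _ _), zero_add]
    rw [← lintegral_map hφ hN, hlaw, lintegral_map hφ hN, mul_comm]
  · have hnone : {y | (x, y) ∈ ({(p, q)} : Set (E × E))} = ∅ := by ext; simp [hxp]
    have hnone' : {y : E | (x, y) ∈ {z : E × E | z.1 = p}} = ∅ := by ext; simp [hxp]
    simp only [hnone, hnone', Measure.restrict_empty, lintegral_zero_measure, mul_zero]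

/-- The process starts afresh after the step at time `s`, and the counts in question are not
affected by steps from `p`, so that the law of what is still to be counted does not depend on
whether this step is to `q`. -/
lemma setLIntegral_stepAt_stepsBefore {ι : Type*} {n p q : E} {S : ι → Set (E × E)}
    (hS : ∀ l y, (p, y) ∉ S l)
    (hlaw : (pathLaw κ q).map (fun X l => stepsBefore n (S l) X) =
      (pathLaw κ p).map (fun X l => stepsBefore n (S l) X))
    {φ : (ι → ℝ≥0∞) → ℝ≥0∞} (hφ : Measurable φ) (s : ℕ) (x : E) :
    ∫⁻ X in stepAt n {(p, q)} s, φ (fun l => stepsBefore n (S l) X) ∂(pathLaw κ x) =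
      κ p {q} * ∫⁻ X in stepAt n {z | z.1 = p} s, φ (fun l => stepsBefore n (S l) X)
        ∂(pathLaw κ x) := by
  rcases eq_or_ne x n with rfl | hx
  · simp only [setLIntegral_stepAt_of_start_eq, mul_zero]
  induction s generalizing φ x with
  | zero => exact setLIntegral_stepAt_zero_stepsBefore κ hS hlaw hφ hx
  | succ s ih =>
    have hF : Measurable fun X => φ fun l => stepsBefore n (S l) X := by fun_prop
    rw [setLIntegral_stepAt_succ κ n x _ s hF hx, setLIntegral_stepAt_succ κ n x _ s hF hx,
      ← lintegral_const_mul _ .of_discrete]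
    refine lintegral_congr fun y => ?_
    let ψ : (ι → ℝ≥0∞) → ℝ≥0∞ := fun v => φ fun l => (S l).indicator 1 (x, y) + v l
    have hψ : Measurable ψ := by fun_prop
    have hfresh : ∀ T, ∫⁻ Y in stepAt n T s, φ (fun l => stepsBefore n (S l) (cons x Y))
        ∂(pathLaw κ y) = ∫⁻ Y in stepAt n T s, ψ (fun l => stepsBefore n (S l) Y)
          ∂(pathLaw κ y) := fun T => by
      refine lintegral_congr_ae (ae_restrict_of_ae ?_)
      filter_upwards [ae_start κ y] with Y hY
      simp only [ψ, stepsBefore_cons hx, hY]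
    rw [hfresh, hfresh]
    rcases eq_or_ne y n with rfl | hy
    · simp only [setLIntegral_stepAt_of_start_eq, mul_zero]
    · exact ih hψ y hy

lemma lintegral_stepsBefore_mul_eq_tsum (μ : Measure (ℕ → E)) (n : E) (S : Set (E × E))
    {F : (ℕ → E) → ℝ≥0∞} (hF : Measurable F) :
    ∫⁻ X, stepsBefore n S X * F X ∂μ = ∑' s, ∫⁻ X in stepAt n S s, F X ∂μ := by
  have hterm : ∀ X, stepsBefore n S X * F X = ∑' s, (stepAt n S s).indicator F X := fun X => by
    rw [stepsBefore, ← ENNReal.tsum_mul_right]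
    refine tsum_congr fun s => ?_
    by_cases hX : X ∈ stepAt n S s <;> simp [hX]
  simp only [hterm, lintegral_tsum fun s =>
    (hF.indicator (measurableSet_stepAt n S s)).aemeasurable,
    lintegral_indicator (measurableSet_stepAt n S _)]

theorem lintegral_stepsBefore_mul {ι : Type*} {n p q : E} {S : ι → Set (E × E)}
    (hS : ∀ l y, (p, y) ∉ S l)
    (hlaw : (pathLaw κ q).map (fun X l => stepsBefore n (S l) X) =
      (pathLaw κ p).map (fun X l => stepsBefore n (S l) X))
    {φ : (ι → ℝ≥0∞) → ℝ≥0∞} (hφ : Measurable φ) (x : E) :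
    ∫⁻ X, stepsBefore n {(p, q)} X * φ (fun l => stepsBefore n (S l) X) ∂(pathLaw κ x) =
      κ p {q} * ∫⁻ X, stepsBefore n {z | z.1 = p} X * φ (fun l => stepsBefore n (S l) X)
        ∂(pathLaw κ x) := by
  have hF : Measurable fun X => φ fun l => stepsBefore n (S l) X := by fun_prop
  rw [lintegral_stepsBefore_mul_eq_tsum _ _ _ hF, lintegral_stepsBefore_mul_eq_tsum _ _ _ hF]
  simp only [setLIntegral_stepAt_stepsBefore κ hS hlaw hφ, ENNReal.tsum_mul_left]

end StepCounts

/-! ### Matrix products -/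

section EntryNorm

variable (M N : Matrix (Fin 3) (Fin 3) ℝ)

lemma entryNorm_nonneg : 0 ≤ entryNorm M :=
  Finset.sum_nonneg fun _ _ => Finset.sum_nonneg fun _ _ => abs_nonneg _

lemma sum_abs_row_le_entryNorm (i : Fin 3) : ∑ j, |M i j| ≤ entryNorm M :=
  Finset.single_le_sum (f := fun i => ∑ j, |M i j|)
    (fun _ _ => Finset.sum_nonneg fun _ _ => abs_nonneg _) (Finset.mem_univ i)

lemma abs_mulVec_le {v : Fin 3 → ℝ} {C : ℝ} (hv : ∀ j, |v j| ≤ C) (i : Fin 3) :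
    |(M *ᵥ v) i| ≤ entryNorm M * C := by
  have hC : 0 ≤ C := (abs_nonneg _).trans (hv 0)
  calc |(M *ᵥ v) i| ≤ ∑ j, |M i j * v j| :=
        Finset.abs_sum_le_sum_abs (fun j => M i j * v j) Finset.univ
    _ = ∑ j, |M i j| * |v j| := by simp only [abs_mul]
    _ ≤ ∑ j, |M i j| * C := by gcongr with j; exact hv j
    _ = (∑ j, |M i j|) * C := (Finset.sum_mul ..).symm
    _ ≤ entryNorm M * C := by gcongr; exact sum_abs_row_le_entryNorm M i

lemma entryNorm_mul_le : entryNorm (M * N) ≤ entryNorm M * entryNorm N :=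
  calc entryNorm (M * N) ≤ ∑ i, ∑ k, ∑ j, |M i j * N j k| := by
        unfold entryNorm
        gcongr with i _ k _
        exact Finset.abs_sum_le_sum_abs (fun j => M i j * N j k) Finset.univ
    _ = ∑ i, ∑ j, |M i j| * ∑ k, |N j k| := by
        simp only [abs_mul, Finset.mul_sum]
        exact Finset.sum_congr rfl fun i _ => Finset.sum_comm
    _ ≤ ∑ i, ∑ j, |M i j| * entryNorm N := by
        gcongr with i _ j _
        exact sum_abs_row_le_entryNorm N j
    _ = entryNorm M * entryNorm N := by simp only [entryNorm, Finset.sum_mul]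

end EntryNorm

/-- The product `A_c A_{c-1} ⋯ A_{c-n+1}` of `n` matrices. -/
def downProd (ω : Env) (c : ℤ) (n : ℕ) : Matrix (Fin 3) (Fin 3) ℝ :=
  ((List.range n).map fun j : ℕ => A ω (c - j)).prod

@[simp] lemma downProd_zero (ω : Env) (c : ℤ) : downProd ω c 0 = 1 := rfl

@[simp] lemma downProd_one (ω : Env) (c : ℤ) : downProd ω c 1 = A ω c := by simp [downProd]

lemma downProd_add (ω : Env) (c : ℤ) (m n : ℕ) :
    downProd ω c (m + n) = downProd ω c m * downProd ω (c - m) n := by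
  simp only [downProd, List.range_add, List.map_append, List.prod_append, List.map_map]
  congr 3
  funext j
  simp [sub_sub]

lemma downProd_succ (ω : Env) (c : ℤ) (n : ℕ) :
    downProd ω c (n + 1) = downProd ω c n * A ω (c - n) := by
  rw [downProd_add, downProd_one]

lemma descProd_eq_downProd (ω : Env) (i k : ℤ) :
    descProd ω i k = downProd ω i ((i - k).toNat + 1) := by
  simp [descProd, downProd, ← List.map_eq_flatMap, Function.comp_def]

lemma descProd_self (ω : Env) (i : ℤ) : descProd ω i i = A ω i := by
  simp [descProd_eq_downProd]

lemma descProd_of_lt (ω : Env) {i k : ℤ} (h : k < i) :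
    descProd ω i k = descProd ω i (k + 1) * A ω k := by
  have hlen : (i - k).toNat = (i - (k + 1)).toNat + 1 := by omega
  have hlast : i - ((i - (k + 1)).toNat + 1 : ℕ) = k := by omega
  rw [descProd_eq_downProd, hlen, downProd_succ, hlast, descProd_eq_downProd]

/-- The environment `ω` seen from `c` in the reversed direction, which exchanges the two orders in
which the matrices are multiplied. -/
def reverse (c : ℤ) (ω : Env) : Env := fun k => ω (c - k)

lemma reverse_reverse (c : ℤ) (ω : Env) : reverse c (reverse c ω) = ω :=
  funext fun k => congrArg ω (sub_sub_cancel c k)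

lemma ascProd_reverse (c : ℤ) (ω : Env) (n : ℕ) : ascProd (reverse c ω) n = downProd ω c n := by
  simp [ascProd, downProd, ← List.map_eq_flatMap, Function.comp_def, A, a, b, reverse]

lemma A_nonneg (ω : Env) (k : ℤ) (l m : Fin 3) : 0 ≤ A ω k l m := by
  have ha : 0 ≤ a ω k := div_nonneg ((ω k).2.1 _) ((ω k).2.1 _)
  have hb : 0 ≤ b ω k := div_nonneg ((ω k).2.1 _) ((ω k).2.1 _)
  fin_cases l <;> fin_cases m <;> simp [A, ha, hb]

/-! ### Bounded functions which are harmonic on a left half-line -/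

/-- The steps to the right have positive probability, and the products `A_i A_{i-1} ⋯` come
arbitrarily close to zero. This is the form in which a negative Lyapunov exponent is used. -/
structure Contracting (ω : Env) : Prop where
  right_pos : ∀ x, 0 < (ω x).1 2
  exists_entryNorm_lt : ∀ (i : ℤ) (ε : ℝ), 0 < ε → ∃ n, entryNorm (downProd ω i n) < ε

/-- `g` is harmonic at `x` for the walk in the environment `ω`. -/
def HarmonicAt (ω : Env) (g : ℤ → ℝ) (x : ℤ) : Prop := g x = ∑ j, (ω x).1 j * g (x + jump j)

/-- The vector of the increments of `g` from `k` to the ends of the jumps of the three types at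
level `k`. -/
def jumpIncr (g : ℤ → ℝ) (k : ℤ) : Fin 3 → ℝ := fun l => g (jumpTo k l) - g k

lemma jumpIncr_succ {ω : Env} {g : ℤ → ℝ} {k : ℤ} (hpos : 0 < (ω k).1 2)
    (hg : HarmonicAt ω g k) : jumpIncr g (k + 1) = A ω k *ᵥ jumpIncr g k := by
  have htotal : (ω k).1 0 + (ω k).1 1 + (ω k).1 2 = 1 := by
    simpa only [Fin.sum_univ_three] using (ω k).2.2
  have hstep : a ω k * (g (k - 1) - g k) + b ω k * (g (k - 2) - g k) = g k - g (k + 1) := by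
    simp only [HarmonicAt, Fin.sum_univ_three, jump, Matrix.cons_val_zero, Matrix.cons_val_one,
      Matrix.cons_val] at hg
    rw [← sub_eq_add_neg, ← sub_eq_add_neg] at hg
    rw [a, b]
    field_simp
    linear_combination (-1 : ℝ) * hg - g k * htotal
  have hlevel : k + 1 - 2 = k - 1 := by ring
  funext l
  fin_cases l <;>
    simp [jumpIncr, jumpTo, A, Matrix.mulVec, dotProduct, Fin.sum_univ_three, hlevel] <;>
    linarith only [hstep]

lemma jumpIncr_eq_downProd_mulVec {ω : Env} (hpos : ∀ x, 0 < (ω x).1 2) {g : ℤ → ℝ} {i : ℤ}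
    (hg : ∀ x ≤ i, HarmonicAt ω g x) (n : ℕ) :
    jumpIncr g (i + 1) = downProd ω i n *ᵥ jumpIncr g (i + 1 - n) := by
  induction n with
  | zero => simp
  | succ n ih =>
    have hlevel : i + 1 - n = i - n + 1 := by ring
    have hlevel' : i + 1 - (n + 1 : ℕ) = i - n := by push_cast; ring
    rw [ih, hlevel, jumpIncr_succ (hpos _) (hg (i - n) (by omega)), Matrix.mulVec_mulVec,
      ← downProd_succ, hlevel']

lemma Contracting.eq_add_one_of_harmonicAt {ω : Env} (hω : Contracting ω) {g : ℤ → ℝ} {i : ℤ}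
    {C : ℝ} (hC : ∀ x, |g x| ≤ C) (hg : ∀ x ≤ i, HarmonicAt ω g x) : g i = g (i + 1) := by
  have hC0 : 0 ≤ C := (abs_nonneg _).trans (hC 0)
  have hincr : ∀ k l, |jumpIncr g k l| ≤ 2 * C := fun k l =>
    (abs_sub _ _).trans (by linarith [hC (jumpTo k l), hC k])
  have hbound : ∀ n, |g i - g (i + 1)| ≤ entryNorm (downProd ω i n) * (2 * C) := fun n => by
    simpa [← jumpIncr_eq_downProd_mulVec hω.right_pos hg, jumpIncr, jumpTo] using
      abs_mulVec_le (downProd ω i n) (hincr (i + 1 - n)) 0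
  refine sub_eq_zero.1 (abs_nonpos_iff.1 (le_of_forall_pos_lt_add fun ε hε => ?_))
  obtain ⟨n, hn⟩ := hω.exists_entryNorm_lt i (ε / (2 * C + 1)) (by positivity)
  rw [lt_div_iff₀ (by positivity)] at hn
  linarith [hbound n, entryNorm_nonneg (downProd ω i n)]

theorem Contracting.eq_of_harmonicAt {ω : Env} (hω : Contracting ω) {g : ℤ → ℝ} {i : ℤ} {C : ℝ}
    (hC : ∀ x, |g x| ≤ C) (hg : ∀ x ≤ i, HarmonicAt ω g x) {x : ℤ} (hx : x ≤ i + 1) :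
    g x = g (i + 1) := by
  induction x, hx using Int.leInductionDown with
  | base => rfl
  | pred x hx ih =>
    rw [← ih, hω.eq_add_one_of_harmonicAt hC fun y hy => hg y (by omega), sub_add_cancel]

/-! ### Almost every environment is contracting -/

lemma ae_tendsto_sum_atBot {Ω : Type*} [MeasurableSpace Ω] {μ : Measure Ω} {Y : ℕ → Ω → ℝ}
    (hindep : Pairwise fun j k => IndepFun (Y j) (Y k) μ)
    (hident : ∀ j, IdentDistrib (Y j) (Y 0) μ μ) (hneg : ∫ ω, Y 0 ω ∂μ < 0) :
    ∀ᵐ ω ∂μ, Filter.Tendsto (fun m => ∑ j ∈ Finset.range m, Y j ω) Filter.atTop Filter.atBot := by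
  have hint : Integrable (Y 0) μ := not_imp_comm.1 integral_undef hneg.ne
  filter_upwards [strong_law_ae_real Y hint hindep hident] with ω hω
  refine (tendsto_natCast_atTop_atTop.atTop_mul_neg hneg hω).congr' ?_
  filter_upwards [Filter.eventually_ne_atTop 0] with m hm
  exact mul_div_cancel₀ _ (Nat.cast_ne_zero.2 hm)

lemma indepFun_infinitePi_of_dependsOn {ι β γ : Type*} {X : ι → Type*} [∀ i, MeasurableSpace (X i)]
    [MeasurableSpace β] [MeasurableSpace γ] {P : (i : ι) → Measure (X i)}
    [∀ i, IsProbabilityMeasure (P i)] {S T : Finset ι} (hST : Disjoint S T)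
    {f : ((i : ι) → X i) → β} {g : ((i : ι) → X i) → γ} (hf : Measurable f) (hg : Measurable g)
    (hfS : DependsOn f S) (hgT : DependsOn g T) : IndepFun f g (Measure.infinitePi P) := by
  classical
  obtain ⟨x₀⟩ := nonempty_of_isProbabilityMeasure (Measure.infinitePi P)
  have hrestrict : ∀ (S : Finset ι) (x : (i : ι) → X i), ∀ i ∈ S,
      Function.updateFinset x₀ S (fun i : S => x i) i = x i := fun S x i hi => by
    simp [Function.updateFinset, hi]
  have hf_factor : (f ∘ Function.updateFinset x₀ S) ∘ (fun x (i : S) => x i) = f :=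
    funext fun x => hfS (hrestrict S x)
  have hg_factor : (g ∘ Function.updateFinset x₀ T) ∘ (fun x (i : T) => x i) = g :=
    funext fun x => hgT (hrestrict T x)
  have hcoord : iIndepFun (fun i (x : (i : ι) → X i) => x i) (Measure.infinitePi P) :=
    iIndepFun_infinitePi (X := fun _ x => x) fun _ => measurable_id
  rw [← hf_factor, ← hg_factor]
  exact (hcoord.indepFun_finset S T hST fun i => measurable_pi_apply i).comp
    (hf.comp measurable_updateFinset) (hg.comp measurable_updateFinset)

lemma measurable_A (k : ℤ) (l m : Fin 3) : Measurable fun ω : Env => A ω k l m := by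
  have hcoord : ∀ j, Measurable fun ω : Env => (ω k).1 j := fun j =>
    (measurable_pi_apply j).comp (measurable_subtype_coe.comp (measurable_pi_apply k))
  have ha : Measurable fun ω : Env => a ω k := (hcoord 1).div (hcoord 2)
  have hb : Measurable fun ω : Env => b ω k := (hcoord 0).div (hcoord 2)
  fin_cases l <;> fin_cases m <;> simp [A, ha, hb]

lemma measurable_downProd (c : ℤ) (n : ℕ) (l m : Fin 3) :
    Measurable fun ω : Env => downProd ω c n l m := by
  induction n generalizing l m with
  | zero => simp only [downProd_zero, measurable_const]
  | succ n ih =>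
    simp only [downProd_succ, Matrix.mul_apply]
    exact Finset.measurable_sum _ fun j _ => (ih l j).mul (measurable_A _ _ _)

lemma measurable_entryNorm_downProd (c : ℤ) (n : ℕ) :
    Measurable fun ω : Env => entryNorm (downProd ω c n) :=
  Finset.measurable_sum _ fun l _ => Finset.measurable_sum _ fun m _ =>
    (measurable_downProd c n l m).norm

lemma dependsOn_downProd (c : ℤ) (n : ℕ) :
    DependsOn (fun ω : Env => downProd ω c n) (Finset.Ioc (c - n) c) := by
  intro ω ω' h
  refine congrArg List.prod (List.map_congr_left fun j hj => ?_)
  rw [List.mem_range] at hj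
  simp only [A, a, b, h (c - j) (by simp; omega)]

lemma measurePreserving_reverse (ν : Measure JumpLaw) [IsProbabilityMeasure ν] (c : ℤ) :
    MeasurePreserving (reverse c) (envLaw ν) (envLaw ν) :=
  ⟨measurable_pi_iff.2 fun _ => measurable_pi_apply _,
    Measure.map_infinitePi_infinitePi_of_inj (P := fun _ : ℤ => ν) (f := fun k : ℤ => c - k)
      sub_right_injective⟩

lemma C2.exists_integral_neg {ν : Measure JumpLaw} (hC2 : C2 ν) :
    ∃ N : ℕ, ∫ ω, Real.log (entryNorm (ascProd ω N)) ∂(envLaw ν) < 0 := by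
  obtain ⟨N, hneg, hN⟩ :=
    ((Filter.eventually_lt_of_limsup_lt hC2).and (Filter.eventually_gt_atTop 0)).exists
  have hneg' : (∫ ω, Real.log (entryNorm (ascProd ω N)) ∂(envLaw ν)) / (N : ℝ) < 0 := by
    exact_mod_cast hneg
  exact ⟨N, by rwa [div_lt_iff₀ (by positivity), zero_mul] at hneg'⟩

lemma ae_tendsto_sum_log_blocks {ν : Measure JumpLaw} [IsProbabilityMeasure ν] {N : ℕ}
    (hneg : ∫ ω, Real.log (entryNorm (ascProd ω N)) ∂(envLaw ν) < 0) (i : ℤ) :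
    ∀ᵐ ω ∂(envLaw ν), Filter.Tendsto (fun m => ∑ j ∈ Finset.range m,
      Real.log (entryNorm (downProd ω (i - (j * N : ℕ)) N))) Filter.atTop Filter.atBot := by
  have hmeas : ∀ c, Measurable fun ω => Real.log (entryNorm (downProd ω c N)) := fun c =>
    Real.measurable_log.comp (measurable_entryNorm_downProd c N)
  have hident : ∀ c, IdentDistrib (fun ω => Real.log (entryNorm (downProd ω c N)))
      (fun ω => Real.log (entryNorm (ascProd ω N))) (envLaw ν) (envLaw ν) := fun c => by
    have hasc : Measurable fun ω => Real.log (entryNorm (ascProd ω N)) := by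
      simpa [← ascProd_reverse, reverse_reverse, Function.comp_def] using
        (hmeas c).comp (measurePreserving_reverse ν c).measurable
    refine ⟨(hmeas c).aemeasurable, hasc.aemeasurable, ?_⟩
    rw [← (measurePreserving_reverse ν c).map_eq, Measure.map_map hasc
      (measurePreserving_reverse ν c).measurable, (measurePreserving_reverse ν c).map_eq]
    simp only [Function.comp_def, ascProd_reverse]
  refine ae_tendsto_sum_atBot (fun j k hjk => ?_) (fun j => (hident _).trans (hident _).symm) ?_
  · refine indepFun_infinitePi_of_dependsOn (Finset.disjoint_left.2 fun x hxj hxk => ?_)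
      (hmeas _) (hmeas _)
      (fun _ _ h => congrArg (fun M => Real.log (entryNorm M)) (dependsOn_downProd _ N h))
      (fun _ _ h => congrArg (fun M => Real.log (entryNorm M)) (dependsOn_downProd _ N h))
    rw [Finset.mem_Ioc] at hxj hxk
    rcases hjk.lt_or_gt with h | h <;>
      have := Nat.mul_le_mul_right N (Nat.succ_le_of_lt h) <;>
      rw [Nat.succ_mul] at this <;> omega
  · rwa [(hident _).integral_eq]

lemma entryNorm_downProd_mul_le (ω : Env) (i : ℤ) (N m : ℕ) :
    entryNorm (downProd ω i (m * N)) ≤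
      3 * Real.exp (∑ j ∈ Finset.range m,
        Real.log (entryNorm (downProd ω (i - (j * N : ℕ)) N))) := by
  induction m with
  | zero => simp [entryNorm, Matrix.one_apply, apply_ite abs]
  | succ m ih =>
    rw [Nat.succ_mul, downProd_add, Finset.sum_range_succ, Real.exp_add, ← mul_assoc]
    exact (entryNorm_mul_le _ _).trans
      (mul_le_mul ih (Real.le_exp_log _) (entryNorm_nonneg _) (by positivity))

lemma ae_envLaw_forall {ν : Measure JumpLaw} [IsProbabilityMeasure ν] {P : JumpLaw → Prop}
    (h : ∀ᵐ p ∂ν, P p) : ∀ᵐ ω ∂(envLaw ν), ∀ x, P (ω x) :=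
  ae_all_iff.2 fun x =>
    (measurePreserving_eval_infinitePi (fun _ : ℤ => ν) x).quasiMeasurePreserving.ae h

theorem ae_contracting {ν : Measure JumpLaw} [IsProbabilityMeasure ν]
    (hpos : ∀ᵐ p ∂ν, 0 < p.1 2) (hC2 : C2 ν) : ∀ᵐ ω ∂(envLaw ν), Contracting ω := by
  obtain ⟨N, hneg⟩ := hC2.exists_integral_neg
  filter_upwards [ae_envLaw_forall hpos, ae_all_iff.2 (ae_tendsto_sum_log_blocks hneg)]
    with ω hω hblocks
  refine ⟨hω, fun i ε hε => ?_⟩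
  have hlim : Filter.Tendsto (fun m => 3 * Real.exp (∑ j ∈ Finset.range m,
      Real.log (entryNorm (downProd ω (i - (j * N : ℕ)) N)))) Filter.atTop (nhds 0) := by
    simpa using (Real.tendsto_exp_atBot.comp (hblocks i)).const_mul 3
  obtain ⟨m, hm⟩ := (hlim.eventually_lt_const hε).exists
  exact ⟨m * N, (entryNorm_downProd_mul_le ω i N m).trans_lt hm⟩

/-! ### The quenched walk -/

section QuenchedWalk

variable (ω : Env)

lemma lintegral_stepKernel (x : ℤ) (f : ℤ → ℝ≥0∞) :
    ∫⁻ y, f y ∂(stepKernel ω x) = ∑ j, ENNReal.ofReal ((ω x).1 j) * f (x + jump j) := by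
  rw [show stepKernel ω x = stepMeasure ω x from rfl, stepMeasure, lintegral_finsetSum_measure]
  simp only [lintegral_smul_measure, lintegral_dirac, smul_eq_mul]

lemma stepKernel_singleton (x : ℤ) (j : Fin 3) :
    stepKernel ω x {x + jump j} = ENNReal.ofReal ((ω x).1 j) := by
  rw [← lintegral_indicator_one .of_discrete, lintegral_stepKernel, Finset.sum_eq_single j]
  · simp
  · intro k _ hk
    have hjump : Function.Injective jump := by decide
    simp [hjump.ne hk]
  · simp

lemma lintegral_quenched (x : ℤ) {F : (ℕ → ℤ) → ℝ≥0∞} (hF : Measurable F) :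
    ∫⁻ X, F X ∂(quenched ω x) =
      ∑ j, ENNReal.ofReal ((ω x).1 j) * ∫⁻ Y, F (cons x Y) ∂(quenched ω (x + jump j)) :=
  (lintegral_pathLaw (stepKernel ω) x hF).trans (lintegral_stepKernel ω x _)

lemma quenched_apply (x : ℤ) {B : Set (ℕ → ℤ)} (hB : MeasurableSet B) :
    quenched ω x B =
      ∑ j, ENNReal.ofReal ((ω x).1 j) * quenched ω (x + jump j) (cons x ⁻¹' B) := by
  rw [← lintegral_indicator_one hB, lintegral_quenched ω x (measurable_one.indicator hB)]
  refine Finset.sum_congr rfl fun j _ => congrArg _ ?_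
  exact lintegral_indicator_one (measurable_cons x hB)

instance (x : ℤ) : IsProbabilityMeasure (quenched ω x) :=
  inferInstanceAs (IsProbabilityMeasure (pathLaw (stepKernel ω) x))

lemma ae_quenched_start (x : ℤ) : ∀ᵐ X ∂(quenched ω x), X 0 = x := ae_start (stepKernel ω) x

/-- A path all of whose steps are possible displacements of the walk. -/
def Legal (X : ℕ → ℤ) : Prop := ∀ t, ∃ j, X (t + 1) = X t + jump j

lemma Legal.tail {X : ℕ → ℤ} (hX : Legal X) : Legal (tail X) := fun t => hX (t + 1)

lemma ae_legal (x : ℤ) : ∀ᵐ X ∂(quenched ω x), Legal X := by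
  refine ae_all_iff.2 fun t => ?_
  have hmeas : ∀ t, MeasurableSet {X : ℕ → ℤ | ∃ j, X (t + 1) = X t + jump j}ᶜ := fun t =>
    (measurableSet_preimage (f := fun X : ℕ → ℤ => (X t, X (t + 1)))
      (t := {z | ∃ j, z.2 = z.1 + jump j}) (by fun_prop) .of_discrete).compl
  induction t generalizing x with
  | zero =>
    refine (quenched_apply ω x (hmeas 0)).trans (Finset.sum_eq_zero fun j _ => ?_)
    refine mul_eq_zero_of_right _ (measure_mono_null (fun Y hY => ?_)
      (ae_quenched_start ω (x + jump j)))
    exact fun hstart => hY ⟨j, hstart⟩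
  | succ t ih =>
    refine (quenched_apply ω x (hmeas (t + 1))).trans (Finset.sum_eq_zero fun j _ => ?_)
    exact mul_eq_zero_of_right _ (ih (x + jump j))

lemma harmonicAt_quenched_real {B : Set (ℕ → ℤ)} (hB : MeasurableSet B) {x : ℤ}
    (hx : cons x ⁻¹' B = B) : HarmonicAt ω (fun y => (quenched ω y).real B) x := by
  rw [HarmonicAt, measureReal_def, quenched_apply ω x hB, hx,
    ENNReal.toReal_sum fun j _ => ENNReal.mul_ne_top ENNReal.ofReal_ne_top (measure_ne_top _ _)]
  refine Finset.sum_congr rfl fun j _ => ?_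
  rw [ENNReal.toReal_mul, ENNReal.toReal_ofReal ((ω x).2.1 j), measureReal_def]

variable {ω}

lemma Contracting.quenched_apply_eq (hω : Contracting ω) {B : Set (ℕ → ℤ)} (hB : MeasurableSet B)
    {i : ℤ} (hinv : ∀ x ≤ i, cons x ⁻¹' B = B) {x : ℤ} (hx : x ≤ i + 1) :
    quenched ω x B = quenched ω (i + 1) B :=
  (measureReal_eq_measureReal_iff).1 <| hω.eq_of_harmonicAt (g := fun y => (quenched ω y).real B)
    (fun y => by rw [abs_of_nonneg measureReal_nonneg]; exact measureReal_le_one)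
    (fun y hy => harmonicAt_quenched_real ω hB (hinv y hy)) hx

lemma Contracting.quenched_map_eq (hω : Contracting ω) {β : Type*} [MeasurableSpace β]
    {N : (ℕ → ℤ) → β} (hN : Measurable N) {i : ℤ} (hinv : ∀ x ≤ i, N ∘ cons x = N) {x : ℤ}
    (hx : x ≤ i + 1) : (quenched ω x).map N = (quenched ω (i + 1)).map N := by
  ext B hB
  rw [Measure.map_apply hN hB, Measure.map_apply hN hB]
  refine hω.quenched_apply_eq (hN hB) (fun y hy => ?_) hx
  rw [← Set.preimage_comp, hinv y hy]

theorem Contracting.ae_exists_eq (hω : Contracting ω) {x n : ℤ} (hx : x ≤ n) :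
    ∀ᵐ X ∂(quenched ω x), ∃ t, X t = n := by
  have hmeas : MeasurableSet {X : ℕ → ℤ | ∃ t, X t = n}ᶜ := by
    rw [Set.ofPred_exists]
    exact (MeasurableSet.iUnion fun t =>
      measurable_pi_apply (X := fun _ : ℕ => ℤ) t (measurableSet_singleton n)).compl
  have hinv : ∀ y ≤ n - 1, cons y ⁻¹' {X : ℕ → ℤ | ∃ t, X t = n}ᶜ = {X | ∃ t, X t = n}ᶜ := by
    intro y hy
    ext Y
    refine not_congr ⟨fun ⟨t, ht⟩ => ?_, fun ⟨t, ht⟩ => ⟨t + 1, ht⟩⟩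
    cases t with
    | zero => exact absurd ht (by rw [cons_zero]; omega)
    | succ t => exact ⟨t, ht⟩
  have hconst := hω.quenched_apply_eq hmeas hinv (x := x) (by omega)
  rw [sub_add_cancel] at hconst
  exact hconst.trans (measure_mono_null (fun X hX hstart => hX ⟨0, hstart⟩) (ae_quenched_start ω n))

end QuenchedWalk

/-! ### The branching process in the path -/

section Branching

/-- The numbers of jumps of the three types at level `k` before the first visit to `n`. For paths
which do not start at `n` this is `U n k`. -/
def levelJumps (n k : ℤ) (X : ℕ → ℤ) : Fin 3 → ℝ≥0∞ :=
  fun l => stepsBefore n {(jumpFrom k l, jumpTo k l)} X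

variable {n i k : ℤ} {X : ℕ → ℤ}

@[fun_prop] lemma measurable_levelJumps (n k : ℤ) : Measurable (levelJumps n k) :=
  measurable_pi_iff.2 fun _ => measurable_stepsBefore _ _

lemma le_jumpFrom (k : ℤ) (l : Fin 3) : k ≤ jumpFrom k l := by
  fin_cases l <;> simp [jumpFrom]

lemma jumpTo_lt (k : ℤ) (l : Fin 3) : jumpTo k l < k := by
  fin_cases l <;> simp [jumpTo]

lemma levelJumps_comp_cons {x : ℤ} (hxn : x ≠ n) (hxk : x < k) :
    levelJumps n k ∘ cons x = levelJumps n k := by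
  funext Y l
  have hnot : (x, Y 0) ∉ ({(jumpFrom k l, jumpTo k l)} : Set (ℤ × ℤ)) := fun h =>
    (hxk.trans_le (le_jumpFrom k l)).ne (congrArg Prod.fst h)
  simp only [Function.comp_apply, levelJumps, stepsBefore_cons hxn, Set.indicator_of_notMem hnot,
    zero_add]

lemma levelJumps_two (n k : ℤ) (X : ℕ → ℤ) : levelJumps n k X 2 = levelJumps n (k + 1) X 1 := by
  have hto : k - 1 = k + 1 - 2 := by ring
  simp [levelJumps, jumpFrom, jumpTo, hto]

lemma levelJumps_of_start_eq (h : X 0 = n) (k : ℤ) : levelJumps n k X = 0 :=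
  funext fun _ => stepsBefore_of_start_eq h

lemma levelJumps_of_start_ne (h : X 0 ≠ n) (k : ℤ) (l : Fin 3) :
    levelJumps n k X l =
      Set.indicator {(jumpFrom k l, jumpTo k l)} 1 (X 0, X 1) + levelJumps n k (tail X) l :=
  stepsBefore_of_start_ne h

variable {ω : Env}

lemma Contracting.ae_levelJumps_eq_zero (hω : Contracting ω) (hk : n ≤ k) {x : ℤ} (hx : x ≤ n) :
    ∀ᵐ X ∂(quenched ω x), levelJumps n k X = 0 := by
  have hlaw := hω.quenched_map_eq (measurable_levelJumps n k) (i := n - 1)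
    (fun y hy => levelJumps_comp_cons (by omega) (by omega)) (x := x) (by omega)
  rw [sub_add_cancel] at hlaw
  have hstart : ∀ᵐ v ∂(quenched ω n).map (levelJumps n k), v = 0 := by
    refine (ae_map_iff (by fun_prop) (measurableSet_singleton 0)).2 ?_
    filter_upwards [ae_quenched_start ω n] with X hX using levelJumps_of_start_eq hX k
  rw [← hlaw] at hstart
  exact ae_of_ae_map (by fun_prop) hstart

lemma indicator_step (p q x y : ℤ) :
    Set.indicator {(p, q)} (1 : ℤ × ℤ → ℝ≥0∞) (x, y) = if x = p ∧ y = q then 1 else 0 := by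
  simp [Set.indicator_apply]

/-- One step of a path changes both sides of `stepsBefore_up_eq` in the same way. -/
lemma indicator_up_add_le {x y : ℤ} {j : Fin 3} (hxy : y = x + jump j) (i : ℤ) :
    Set.indicator {(i, i + 1)} 1 (x, y) + (if y ≤ i then 1 else 0) =
      (if x ≤ i then 1 else 0) + ∑ l, Set.indicator
        {(jumpFrom (i + 1) l, jumpTo (i + 1) l)} (1 : ℤ × ℤ → ℝ≥0∞) (x, y) := by
  have hstep : y = x - 2 ∨ y = x - 1 ∨ y = x + 1 := by
    fin_cases j
    exacts [.inl hxy, .inr (.inl hxy), .inr (.inr hxy)]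
  simp only [Fin.sum_univ_three, jumpFrom, jumpTo, Matrix.cons_val_zero, Matrix.cons_val_one,
    Matrix.cons_val]
  simp only [indicator_step]
  split_ifs <;> first | omega | simp

/-- Crossings of `(i, i + 1)` alternate in direction, and those to the left are the jumps at level
`i + 1`. -/
theorem stepsBefore_up_eq (hi : i < n) (hX : Legal X) (hhit : ∃ t, X t = n) :
    stepsBefore n {(i, i + 1)} X =
      (if X 0 ≤ i then 1 else 0) + ∑ l, levelJumps n (i + 1) X l := by
  obtain ⟨t, ht⟩ := hhit
  induction t generalizing X with
  | zero =>
    rw [stepsBefore_of_start_eq ht, levelJumps_of_start_eq ht, if_neg (by omega)]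
    simp
  | succ t ih =>
    rcases eq_or_ne (X 0) n with h0 | h0
    · rw [stepsBefore_of_start_eq h0, levelJumps_of_start_eq h0, if_neg (by omega)]
      simp
    · obtain ⟨j, hj⟩ := hX 0
      rw [zero_add] at hj
      simp only [levelJumps_of_start_ne h0, Finset.sum_add_distrib]
      rw [stepsBefore_of_start_ne h0, ih hX.tail ht, ← add_assoc, ← add_assoc, tail_apply,
        zero_add, indicator_up_add_le hj]

lemma Contracting.lintegral_stepsBefore_jump_mul (hω : Contracting ω) (hi : i < n)
    {φ : (Fin 3 → ℝ≥0∞) → ℝ≥0∞} (hφ : Measurable φ) (x : ℤ) (j : Fin 3) :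
    ∫⁻ X, stepsBefore n {(i, i + jump j)} X * φ (levelJumps n (i + 1) X) ∂(quenched ω x) =
      ENNReal.ofReal ((ω i).1 j) *
        ∫⁻ X, stepsBefore n {z | z.1 = i} X * φ (levelJumps n (i + 1) X) ∂(quenched ω x) := by
  have hle : ∀ j, jump j ≤ 1 := by decide
  have hlaw : ∀ y ≤ i + 1, (quenched ω y).map (levelJumps n (i + 1)) =
      (quenched ω (i + 1)).map (levelJumps n (i + 1)) := fun y hy =>
    hω.quenched_map_eq (measurable_levelJumps n (i + 1))
      (fun z hz => levelJumps_comp_cons (by omega) (by omega)) hy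
  rw [← stepKernel_singleton]
  refine lintegral_stepsBefore_mul (stepKernel ω) (fun l y h => ?_)
    ((hlaw (i + jump j) (by have := hle j; omega)).trans (hlaw i (by omega)).symm) hφ x
  exact (Int.lt_of_add_one_le (le_jumpFrom (i + 1) l)).ne (congrArg Prod.fst h)

lemma Contracting.lintegral_stepsBefore_jump_mul_eq_up (hω : Contracting ω) (hi : i < n)
    {φ : (Fin 3 → ℝ≥0∞) → ℝ≥0∞} (hφ : Measurable φ) (x : ℤ) (j : Fin 3) :
    ∫⁻ X, stepsBefore n {(i, i + jump j)} X * φ (levelJumps n (i + 1) X) ∂(quenched ω x) =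
      ENNReal.ofReal ((ω i).1 j / (ω i).1 2) *
        ∫⁻ X, stepsBefore n {(i, i + 1)} X * φ (levelJumps n (i + 1) X) ∂(quenched ω x) := by
  have hup := hω.lintegral_stepsBefore_jump_mul hi hφ x 2
  rw [show jump 2 = 1 from rfl] at hup
  rw [hup, hω.lintegral_stepsBefore_jump_mul hi hφ, ← mul_assoc, ENNReal.ofReal_div_of_pos
    (hω.right_pos i), ENNReal.div_mul_cancel (ENNReal.ofReal_pos.2 (hω.right_pos i)).ne'
    ENNReal.ofReal_ne_top]

theorem Contracting.lintegral_levelJumps_mul (hω : Contracting ω) (hi : i < n)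
    {φ : (Fin 3 → ℝ≥0∞) → ℝ≥0∞} (hφ : Measurable φ) {x : ℤ} (hx : x ≤ n) (m : Fin 3) :
    ∫⁻ X, levelJumps n i X m * φ (levelJumps n (i + 1) X) ∂(quenched ω x) =
      ∫⁻ X, (((if x ≤ i then Pi.single 0 1 else 0) + levelJumps n (i + 1) X) ᵥ*
        (A ω i).map ENNReal.ofReal) m * φ (levelJumps n (i + 1) X) ∂(quenched ω x) := by
  have hup : ∀ᵐ X ∂(quenched ω x), stepsBefore n {(i, i + 1)} X =
      ∑ l, ((if x ≤ i then Pi.single 0 1 else 0 : Fin 3 → ℝ≥0∞) + levelJumps n (i + 1) X) l := by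
    filter_upwards [ae_legal ω x, hω.ae_exists_eq hx, ae_quenched_start ω x] with X hX hhit hstart
    rw [stepsBefore_up_eq hi hX hhit, hstart]
    simp only [Pi.add_apply, Finset.sum_add_distrib]
    split_ifs <;> simp
  have hchildren : ∀ j, ∫⁻ X, stepsBefore n {(i, i + jump j)} X * φ (levelJumps n (i + 1) X)
      ∂(quenched ω x) = ∫⁻ X, (∑ l, ((if x ≤ i then Pi.single 0 1 else 0 : Fin 3 → ℝ≥0∞) +
        levelJumps n (i + 1) X) l) * ENNReal.ofReal ((ω i).1 j / (ω i).1 2) *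
          φ (levelJumps n (i + 1) X) ∂(quenched ω x) := fun j => by
    rw [hω.lintegral_stepsBefore_jump_mul_eq_up hi hφ x j, ← lintegral_const_mul _ (by fun_prop)]
    refine lintegral_congr_ae ?_
    filter_upwards [hup] with X hX
    rw [hX]
    ring
  fin_cases m
  · refine (hchildren 1).trans ?_
    simp [Matrix.vecMul, dotProduct, Fin.sum_univ_three, A, a, add_mul]
  · refine (hchildren 0).trans ?_
    simp [Matrix.vecMul, dotProduct, Fin.sum_univ_three, A, b, add_mul]
  · refine lintegral_congr fun X => congrArg (· * _) ?_
    split_ifs <;> simp [Matrix.vecMul, dotProduct, Fin.sum_univ_three, A, levelJumps_two]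

end Branching

/-! ### Hitting times and step counts -/

section HittingTime

variable {n : ℤ} {s : ℕ} {X : ℕ → ℤ}

lemma lt_hit_iff : (s : ℕ∞) < hit n X ↔ ∀ t, 0 < t → t ≤ s → X t ≠ n := by
  have hle : (s + 1 : ℕ∞) ≤ hit n X ↔ ∀ t : ℕ, 0 < t ∧ X t = n → s + 1 ≤ t := by
    simp only [hit, le_iInf_iff]
    exact_mod_cast Iff.rfl
  rw [← ENat.add_one_le_iff (ENat.natCast_ne_top s), hle]
  exact ⟨fun h t ht hts htn => absurd (h t ⟨ht, htn⟩) (by omega),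
    fun h t ht => not_lt.1 fun hts => h t ht.1 (by omega) ht.2⟩

lemma succ_lt_hit_iff : ((s + 1 : ℕ) : ℕ∞) < hit n X ↔ Avoids n s (tail X) := by
  rw [lt_hit_iff]
  exact ⟨fun h r hr => h (r + 1) r.succ_pos (by omega), fun h t ht hts => by
    obtain ⟨r, rfl⟩ := Nat.exists_eq_add_one.2 ht
    exact h r (by omega)⟩

lemma lt_hit_iff_avoids (h0 : X 0 ≠ n) : (s : ℕ∞) < hit n X ↔ Avoids n s X := by
  rw [lt_hit_iff]
  exact ⟨fun h r hr => r.eq_zero_or_pos.elim (fun hr0 => hr0 ▸ h0) fun hr0 => h r hr0 hr,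
    fun h t _ hts => h t hts⟩

lemma toENNReal_encard_eq_tsum (S : Set ℕ) : (S.encard : ℝ≥0∞) = ∑' s, S.indicator 1 s := by
  rw [← tsum_subtype, ← ENNReal.tsum_set_one]
  rfl

lemma toENNReal_hit_eq_stepsBefore_univ (h0 : X 0 ≠ n) :
    (hit n X : ℝ≥0∞) = stepsBefore n Set.univ X := by
  have hcard : hit n X = {s : ℕ | (s : ℕ∞) < hit n X}.encard := by
    cases hit n X with
    | top => simp
    | coe m =>
      simpa [Set.Iio_def] using (Set.encard_coe_eq_coe_finsetCard (Finset.range m)).symm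
  rw [hcard, toENNReal_encard_eq_tsum, stepsBefore]
  exact tsum_congr fun s => Set.indicator_eq_indicator
    ((lt_hit_iff_avoids h0).trans (and_iff_left trivial).symm) rfl

lemma toENNReal_stepCount {p q : ℤ} (hq : q ≠ n) :
    (stepCount n p q X : ℝ≥0∞) =
      Set.indicator {(p, q)} 1 (X 0, X 1) + stepsBefore n {(p, q)} (tail X) := by
  rw [stepCount, toENNReal_encard_eq_tsum, tsum_eq_zero_add' ENNReal.summable,
    tsum_eq_zero_add' ENNReal.summable, stepsBefore, ← add_assoc]
  congr 1
  · rw [Set.indicator_of_notMem (fun h => h.1.false), zero_add]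
    refine Set.indicator_eq_indicator ?_ rfl
    simp only [Set.mem_ofPred_eq, Set.mem_singleton_iff, Prod.mk.injEq, succ_lt_hit_iff,
      avoids_zero, tail_apply]
    exact ⟨fun h => h.2.2, fun h => ⟨one_pos, fun h1 => hq (h.2.symm.trans h1), h⟩⟩
  · refine tsum_congr fun s => Set.indicator_eq_indicator ?_ rfl
    simp only [Set.mem_ofPred_eq, succ_lt_hit_iff, stepAt, Set.mem_singleton_iff, Prod.mk.injEq,
      tail_apply, Nat.add_sub_cancel]
    refine ⟨fun h => ⟨fun r hr => h.2.1 r (by omega), h.2.2⟩, fun h => ⟨Nat.succ_pos _, ?_, h.2⟩⟩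
    intro r hr
    rcases Nat.le_succ_iff.1 hr with hr | rfl
    · exact h.1 r hr
    · exact fun hr => hq (h.2.2.symm.trans hr)

lemma toENNReal_U {k : ℤ} (hk : k ≤ n) (m : Fin 3) :
    (U n k X m : ℝ≥0∞) = Set.indicator {(jumpFrom k m, jumpTo k m)} 1 (X 0, X 1) +
      levelJumps n k (tail X) m :=
  toENNReal_stepCount ((jumpTo_lt k m).trans_le hk).ne

lemma toENNReal_U_eq_levelJumps {k : ℤ} (hk : k ≤ n) (h0 : X 0 ≠ n) (m : Fin 3) :
    (U n k X m : ℝ≥0∞) = levelJumps n k X m :=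
  (toENNReal_U hk m).trans (levelJumps_of_start_ne h0 k m).symm

end HittingTime

/-! ### Conditional means of the numbers of jumps -/

section MeanOffspring

lemma ofReal_dotProduct {ι : Type*} [Fintype ι] {v w : ι → ℝ} (hv : 0 ≤ v) (hw : 0 ≤ w) :
    ENNReal.ofReal (v ⬝ᵥ w) =
      (fun i => ENNReal.ofReal (v i)) ⬝ᵥ fun i => ENNReal.ofReal (w i) := by
  simp only [dotProduct, ENNReal.ofReal_sum_of_nonneg fun i _ => mul_nonneg (hv i) (hw i),
    ENNReal.ofReal_mul (hv _)]

lemma ofReal_vecMul {ι κ : Type*} [Fintype ι] {v : ι → ℝ} {M : Matrix ι κ ℝ} (hv : 0 ≤ v)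
    (hM : ∀ l m, 0 ≤ M l m) (m : κ) :
    ENNReal.ofReal ((v ᵥ* M) m) =
      ((fun l => ENNReal.ofReal (v l)) ᵥ* M.map ENNReal.ofReal) m :=
  ofReal_dotProduct hv fun l => hM l m

variable {n k i : ℤ} {ω : Env}

lemma measurable_toENNReal_U (hk : k ≤ n) (m : Fin 3) :
    Measurable fun X => (U n k X m : ℝ≥0∞) := by
  have hind : Measurable (Set.indicator {(jumpFrom k m, jumpTo k m)} (1 : ℤ × ℤ → ℝ≥0∞)) :=
    .of_discrete
  have hstep : Measurable fun X : ℕ → ℤ => (X 0, X 1) := by fun_prop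
  simp only [toENNReal_U hk]
  exact (hind.comp hstep).add (by fun_prop)

lemma exists_jumpTo_eq (k : ℤ) (l : Fin 3) : ∃ j, jumpTo k l = jumpFrom k l + jump j := by
  fin_cases l
  · exact ⟨1, rfl⟩
  · exact ⟨0, rfl⟩
  · exact ⟨0, show k - 1 = k + 1 + -2 by ring⟩

lemma Contracting.lintegral_levelJumps_add_one (hω : Contracting ω) {x : ℤ} (hx : x ≤ i)
    (m : Fin 3) :
    ∫⁻ X, levelJumps (i + 1) i X m ∂(quenched ω x) = ENNReal.ofReal (A ω i 0 m) := by
  have hmean := hω.lintegral_levelJumps_mul (lt_add_one i) (φ := 1) measurable_one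
    (hx.trans (lt_add_one i).le) m
  simp only [Pi.one_apply, mul_one, if_pos hx] at hmean
  rw [hmean, lintegral_congr_ae (g := fun _ => ENNReal.ofReal (A ω i 0 m)), lintegral_const,
    measure_univ, mul_one]
  filter_upwards [hω.ae_levelJumps_eq_zero le_rfl (hx.trans (lt_add_one i).le)] with X hX
  rw [hX, add_zero, Matrix.single_one_vecMul, Matrix.row_apply, Matrix.map_apply]

/-- The second row of `A` differs from the others by the jump of type 2 at level `i + 1` itself,
which is at the same time a jump of type 3 at level `i`. -/
lemma indicator_jump_add_A (ω : Env) (i : ℤ) (l m : Fin 3) :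
    Set.indicator {(jumpFrom i m, jumpTo i m)} 1 (jumpFrom (i + 1) l, jumpTo (i + 1) l) +
      ENNReal.ofReal (A ω i 0 m) = ENNReal.ofReal (A ω i l m) := by
  rw [indicator_step]
  fin_cases l <;> fin_cases m <;> simp [jumpFrom, jumpTo, A] <;> omega

theorem Contracting.meanOffspring_eq (hω : Contracting ω) (hpos : ∀ x j, 0 < (ω x).1 j) (i : ℤ) :
    meanOffspring ω i = (A ω i).map ENNReal.ofReal := by
  ext l m
  obtain ⟨j, hj⟩ := exists_jumpTo_eq (i + 1) l
  have hstep : stepKernel ω (jumpFrom (i + 1) l) {jumpTo (i + 1) l} ≠ 0 := by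
    rw [hj, stepKernel_singleton]
    exact (ENNReal.ofReal_pos.2 (hpos _ j)).ne'
  have hcond : (quenched ω (jumpFrom (i + 1) l))[|{X : ℕ → ℤ | X 1 = jumpTo (i + 1) l}] =
      (quenched ω (jumpTo (i + 1) l)).map (cons (jumpFrom (i + 1) l)) :=
    pathLaw_cond_eq_map_cons (stepKernel ω) _ _ hstep
  have hi : i ≤ i + 1 := (lt_add_one i).le
  have hlevel : ∀ᵐ Y ∂(quenched ω (jumpTo (i + 1) l)),
      (U (i + 1) i (cons (jumpFrom (i + 1) l) Y) m : ℝ≥0∞) =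
        Set.indicator {(jumpFrom i m, jumpTo i m)} 1 (jumpFrom (i + 1) l, jumpTo (i + 1) l) +
          levelJumps (i + 1) i Y m := by
    filter_upwards [ae_quenched_start ω (jumpTo (i + 1) l)] with Y hY
    rw [toENNReal_U hi, tail_cons, ← hY]
    rfl
  rw [meanOffspring, Matrix.of_apply, hcond,
    lintegral_map (measurable_toENNReal_U hi m) (measurable_cons _), lintegral_congr_ae hlevel,
    lintegral_add_left measurable_const, lintegral_const, measure_univ, mul_one,
    hω.lintegral_levelJumps_add_one (Int.lt_add_one_iff.1 (jumpTo_lt (i + 1) l)),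
    indicator_jump_add_A, Matrix.map_apply]

lemma measurableSet_levelEvent (hk : k ≤ n) (u : Fin 3 → ℕ) :
    MeasurableSet (levelEvent n k u) := by
  have heq : levelEvent n k u = ⋂ l, {X | (U n k X l : ℝ≥0∞) = u l} := by
    ext X
    simp only [levelEvent, Set.mem_ofPred_eq, Set.mem_iInter, ← ENat.toENNReal_inj,
      ENat.toENNReal_coe]
  rw [heq]
  exact .iInter fun l => measurableSet_eq_fun (measurable_toENNReal_U hk l) measurable_const

lemma setLIntegral_levelEvent (hk : k ≤ n) {x : ℤ} (hx : x ≠ n) (u : Fin 3 → ℕ)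
    (F : (ℕ → ℤ) → ℝ≥0∞) :
    ∫⁻ X in levelEvent n k u, F X ∂(quenched ω x) =
      ∫⁻ X, F X * Set.indicator {fun l => (u l : ℝ≥0∞)} 1 (levelJumps n k X)
        ∂(quenched ω x) := by
  rw [← lintegral_indicator (measurableSet_levelEvent hk u)]
  refine lintegral_congr_ae ?_
  filter_upwards [ae_quenched_start ω x] with X hX
  have hmem : X ∈ levelEvent n k u ↔ levelJumps n k X = fun l => (u l : ℝ≥0∞) := by
    simp only [levelEvent, Set.mem_ofPred_eq, funext_iff, ← ENat.toENNReal_inj,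
      ENat.toENNReal_coe, toENNReal_U_eq_levelJumps hk (hX.trans_ne hx)]
  by_cases h : X ∈ levelEvent n k u
  · simp [h, hmem.1 h]
  · simp [h, mt hmem.2 h]

lemma ofReal_vecMul_A (ω : Env) (i : ℤ) (u : Fin 3 → ℕ) (m : Fin 3) :
    ENNReal.ofReal ((((fun l => (u l : ℝ)) + immigrant i) ᵥ* A ω i) m) =
      (((if 0 ≤ i then Pi.single 0 1 else 0) + fun l => (u l : ℝ≥0∞)) ᵥ*
        (A ω i).map ENNReal.ofReal) m := by
  have himm : 0 ≤ immigrant i := by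
    unfold immigrant
    split_ifs
    exacts [Pi.single_nonneg.2 zero_le_one, le_rfl]
  have hu : 0 ≤ fun l => (u l : ℝ) := fun l => (u l).cast_nonneg
  rw [ofReal_vecMul (add_nonneg hu himm) (A_nonneg ω i)]
  congr 2
  funext l
  rw [Pi.add_apply, ENNReal.ofReal_add (hu l) (himm l), ENNReal.ofReal_natCast, add_comm,
    Pi.add_apply]
  congr 1
  unfold immigrant
  split_ifs
  · simp [Pi.single_apply, apply_ite ENNReal.ofReal]
  · simp

lemma Contracting.setLIntegral_levelEvent_U (hω : Contracting ω) (hn : 0 < n) (hi : i < n)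
    (u : Fin 3 → ℕ) (m : Fin 3) :
    ∫⁻ X in levelEvent n (i + 1) u, (U n i X m : ℝ≥0∞) ∂(quenched ω 0) =
      ENNReal.ofReal ((((fun l => (u l : ℝ)) + immigrant i) ᵥ* A ω i) m) *
        quenched ω 0 (levelEvent n (i + 1) u) := by
  let φ : (Fin 3 → ℝ≥0∞) → ℝ≥0∞ := Set.indicator {fun l => (u l : ℝ≥0∞)} 1
  have hφ : Measurable φ := measurable_one.indicator (measurableSet_singleton _)
  have hφ_level : Measurable fun X => φ (levelJumps n (i + 1) X) := by fun_prop
  have hlevel : ∀ᵐ X ∂(quenched ω 0), (U n i X m : ℝ≥0∞) = levelJumps n i X m := by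
    filter_upwards [ae_quenched_start ω 0] with X hX
    exact toENNReal_U_eq_levelJumps hi.le (hX.trans_ne hn.ne) m
  calc ∫⁻ X in levelEvent n (i + 1) u, (U n i X m : ℝ≥0∞) ∂(quenched ω 0)
      = ∫⁻ X, levelJumps n i X m * φ (levelJumps n (i + 1) X) ∂(quenched ω 0) := by
        rw [setLIntegral_levelEvent hi hn.ne]
        refine lintegral_congr_ae ?_
        filter_upwards [hlevel] with X hX
        rw [hX]
    _ = ∫⁻ X, (((if 0 ≤ i then Pi.single 0 1 else 0) + levelJumps n (i + 1) X) ᵥ*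
          (A ω i).map ENNReal.ofReal) m * φ (levelJumps n (i + 1) X) ∂(quenched ω 0) :=
        hω.lintegral_levelJumps_mul hi hφ hn.le m
    _ = ∫⁻ X, ENNReal.ofReal ((((fun l => (u l : ℝ)) + immigrant i) ᵥ* A ω i) m) *
          φ (levelJumps n (i + 1) X) ∂(quenched ω 0) := by
        refine lintegral_congr fun X => ?_
        by_cases hX : levelJumps n (i + 1) X = fun l => (u l : ℝ≥0∞)
        · rw [hX, ofReal_vecMul_A]
        · simp [φ, hX]
    _ = _ := by
        rw [← setLIntegral_one, setLIntegral_levelEvent hi hn.ne, lintegral_const_mul _ hφ_level]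
        simp only [one_mul, φ]

theorem Contracting.lintegral_U_cond_levelEvent (hω : Contracting ω) (hn : 0 < n) (hi : i < n)
    {u : Fin 3 → ℕ} (hu : quenched ω 0 (levelEvent n (i + 1) u) ≠ 0) (m : Fin 3) :
    ∫⁻ X, (U n i X m : ℝ≥0∞) ∂((quenched ω 0)[|levelEvent n (i + 1) u]) =
      ENNReal.ofReal ((((fun l => (u l : ℝ)) + immigrant i) ᵥ* A ω i) m) := by
  rw [ProbabilityTheory.cond, lintegral_smul_measure, hω.setLIntegral_levelEvent_U hn hi,
    smul_eq_mul, mul_left_comm, ENNReal.inv_mul_cancel hu (measure_ne_top _ _), mul_one]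

end MeanOffspring

/-! ### The mean hitting time -/

section MeanHittingTime

lemma tsum_indicator_jump (x y : ℤ) (l : Fin 3) :
    ∑' k, Set.indicator {(jumpFrom k l, jumpTo k l)} (1 : ℤ × ℤ → ℝ≥0∞) (x, y) =
      if y = x + ![-1, -2, -2] l then 1 else 0 := by
  obtain ⟨c, hfrom, hto⟩ : ∃ c, (∀ k, jumpFrom k l = k + c) ∧
      ∀ k, jumpTo k l = k + c + ![-1, -2, -2] l := by
    fin_cases l
    · exact ⟨0, fun k => (add_zero k).symm, fun k => by simp [jumpTo, sub_eq_add_neg]⟩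
    · exact ⟨0, fun k => (add_zero k).symm, fun k => by simp [jumpTo, sub_eq_add_neg]⟩
    · exact ⟨1, fun k => rfl, fun k => by simp [jumpTo]; ring⟩
  simp only [indicator_step, hfrom, hto]
  rw [tsum_eq_single (x - c) fun k hk => if_neg fun h => hk (by omega), sub_add_cancel]
  simp only [true_and]

/-- This is where the weights `2, 1, 2` come from: a step to `x - 1`, of type 1, delays the walk by
`2`; a step to `x - 2`, which is of type 2 at level `x` and of type 3 at level `x - 1`, by `1 + 2`.
-/
lemma one_add_toNat_sub {n x y : ℤ} {j : Fin 3} (hxy : y = x + jump j) (hx : x < n) :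
    1 + ((n - y).toNat : ℝ≥0∞) = (n - x).toNat +
      ∑' k, (fun l => Set.indicator {(jumpFrom k l, jumpTo k l)} (1 : ℤ × ℤ → ℝ≥0∞) (x, y)) ⬝ᵥ
        ![2, 1, 2] := by
  have hcost : ∑' k, (fun l => Set.indicator {(jumpFrom k l, jumpTo k l)}
      (1 : ℤ × ℤ → ℝ≥0∞) (x, y)) ⬝ᵥ ![2, 1, 2] = (![3, 2, 0] j : ℕ) := by
    simp only [dotProduct, Summable.tsum_finsetSum fun _ _ => ENNReal.summable,
      ENNReal.tsum_mul_right, tsum_indicator_jump, hxy, add_right_inj]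
    fin_cases j <;> simp [jump, Fin.sum_univ_three]
    norm_num
  have hdist : 1 + (n - y).toNat = (n - x).toNat + ![3, 2, 0] j := by
    fin_cases j <;> simp [jump] at hxy ⊢ <;> omega
  rw [hcost]
  exact_mod_cast hdist

theorem stepsBefore_univ_eq {n : ℤ} {X : ℕ → ℤ} (hX : Legal X) (hhit : ∃ t, X t = n)
    (h0 : X 0 ≤ n) :
    stepsBefore n Set.univ X = (n - X 0).toNat + ∑' k, levelJumps n k X ⬝ᵥ ![2, 1, 2] := by
  obtain ⟨t, ht⟩ := hhit
  induction t generalizing X with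
  | zero => simp [stepsBefore_of_start_eq ht, levelJumps_of_start_eq ht, ht]
  | succ t ih =>
    rcases h0.eq_or_lt with h0 | h0
    · simp [stepsBefore_of_start_eq h0, levelJumps_of_start_eq h0, h0]
    · obtain ⟨j, hj⟩ := hX 0
      have hle : ∀ j, jump j ≤ 1 := by decide
      have htail : tail X 0 ≤ n := by
        have := hle j
        rw [tail_apply]
        omega
      have hlevel : ∀ k, levelJumps n k X =
          (fun l => Set.indicator {(jumpFrom k l, jumpTo k l)} 1 (X 0, X 1)) +
            levelJumps n k (tail X) := fun k => funext (levelJumps_of_start_ne h0.ne k)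
      simp only [hlevel, add_dotProduct]
      rw [stepsBefore_of_start_ne h0.ne, Set.indicator_of_mem (Set.mem_univ _), ih hX.tail htail ht,
        ENNReal.tsum_add, ← add_assoc, ← add_assoc, ← one_add_toNat_sub hj h0]
      rfl

/-- The mean numbers of jumps of the three types at level `k` before the first visit to `n`, for
the walk started at `0`: the mean of generation `k` of the branching process. -/
def meanJumps (ω : Env) (n k : ℤ) : Fin 3 → ℝ≥0∞ := fun m => ∫⁻ X, levelJumps n k X m ∂quenched ω 0

/-- The mean numbers of the descendants at level `k`, by type, of one individual of type 1 at level
`i + 1`. -/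
def meanDescendants (ω : Env) (i k : ℤ) : Fin 3 → ℝ≥0∞ :=
  fun m => if k ≤ i then ENNReal.ofReal (descProd ω i k 0 m) else 0

variable {ω : Env}

lemma Contracting.lintegral_hit (hω : Contracting ω) {n : ℤ} (hn : 0 < n) :
    ∫⁻ X, (hit n X : ℝ≥0∞) ∂(quenched ω 0) = n.toNat + ∑' k, meanJumps ω n k ⬝ᵥ ![2, 1, 2] := by
  have hpath : ∀ᵐ X ∂(quenched ω 0),
      (hit n X : ℝ≥0∞) = n.toNat + ∑' k, levelJumps n k X ⬝ᵥ ![2, 1, 2] := by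
    filter_upwards [ae_legal ω 0, hω.ae_exists_eq hn.le, ae_quenched_start ω 0] with X hX hhit h0
    rw [toENNReal_hit_eq_stepsBefore_univ (h0.trans_ne hn.ne),
      stepsBefore_univ_eq hX hhit (h0.trans_le hn.le), h0, sub_zero]
  have hmeas : ∀ k l, Measurable fun X => levelJumps n k X l := fun k l => by fun_prop
  rw [lintegral_congr_ae hpath, lintegral_add_left measurable_const, lintegral_const, measure_univ,
    mul_one, lintegral_tsum fun k => by unfold dotProduct; fun_prop]
  refine congrArg _ (tsum_congr fun k => ?_)
  simp only [dotProduct, meanJumps]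
  rw [lintegral_finsetSum _ fun l _ => (hmeas k l).mul_const _]
  simp only [lintegral_mul_const _ (hmeas k _)]

lemma Contracting.meanJumps_of_le (hω : Contracting ω) {n k : ℤ} (hn : 0 ≤ n) (hk : n ≤ k) :
    meanJumps ω n k = 0 := by
  funext m
  refine (lintegral_congr_ae ?_).trans lintegral_zero
  filter_upwards [hω.ae_levelJumps_eq_zero hk hn] with X hX using congrFun hX m

lemma Contracting.meanJumps_of_lt (hω : Contracting ω) {n k : ℤ} (hn : 0 ≤ n) (hk : k < n) :
    meanJumps ω n k = ((if 0 ≤ k then Pi.single 0 1 else 0) + meanJumps ω n (k + 1)) ᵥ*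
      (A ω k).map ENNReal.ofReal := by
  funext m
  have hmean := hω.lintegral_levelJumps_mul hk (φ := 1) measurable_one hn m
  simp only [Pi.one_apply, mul_one] at hmean
  have hmeas : ∀ l, Measurable fun X => levelJumps n (k + 1) X l := fun l => by fun_prop
  simp only [meanJumps, hmean, Matrix.vecMul, dotProduct, Pi.add_apply]
  rw [lintegral_finsetSum _ fun l _ => ((hmeas l).const_add _).mul_const _]
  refine Finset.sum_congr rfl fun l _ => ?_
  rw [lintegral_mul_const _ ((hmeas l).const_add _), lintegral_add_left measurable_const,
    lintegral_const, measure_univ, mul_one]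

lemma descProd_nonneg (ω : Env) (i k : ℤ) (l m : Fin 3) : 0 ≤ descProd ω i k l m := by
  rw [descProd_eq_downProd]
  generalize (i - k).toNat + 1 = n
  induction n generalizing m with
  | zero =>
    rw [downProd_zero, Matrix.one_apply]
    split_ifs
    exacts [zero_le_one, le_rfl]
  | succ n ih =>
    rw [downProd_succ, Matrix.mul_apply]
    exact Finset.sum_nonneg fun j _ => mul_nonneg (ih j) (A_nonneg _ _ _ _)

lemma meanDescendants_of_lt {i k : ℤ} (h : i < k) : meanDescendants ω i k = 0 :=
  funext fun _ => if_neg h.not_ge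

lemma meanDescendants_eq_vecMul (ω : Env) (i k : ℤ) :
    meanDescendants ω i k = ((if k = i then Pi.single 0 1 else 0) + meanDescendants ω i (k + 1)) ᵥ*
      (A ω k).map ENNReal.ofReal := by
  rcases lt_trichotomy k i with hk | rfl | hk
  · funext m
    rw [if_neg hk.ne, zero_add]
    have hrow : descProd ω i k 0 m = (descProd ω i (k + 1) 0 ᵥ* A ω k) m := by
      rw [descProd_of_lt ω hk, Matrix.mul_apply]
      rfl
    have hnext : meanDescendants ω i (k + 1) = fun l => ENNReal.ofReal (descProd ω i (k + 1) 0 l) :=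
      funext fun _ => if_pos (Int.add_one_le_of_lt hk)
    rw [hnext, ← ofReal_vecMul (descProd_nonneg ω i (k + 1) 0) (A_nonneg ω k), ← hrow]
    exact if_pos hk.le
  · rw [meanDescendants_of_lt (lt_add_one k), if_pos rfl, add_zero, Matrix.single_one_vecMul]
    funext m
    simp [meanDescendants, descProd_self]
  · rw [meanDescendants_of_lt hk, meanDescendants_of_lt (hk.trans (lt_add_one k)), if_neg hk.ne',
      add_zero, Matrix.zero_vecMul]

theorem Contracting.meanJumps_eq_sum (hω : Contracting ω) (n : ℕ) (k : ℤ) :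
    meanJumps ω n k = ∑ i ∈ Finset.range n, meanDescendants ω i k := by
  have habove : ∀ k, (n : ℤ) ≤ k → meanJumps ω n k = ∑ i ∈ Finset.range n, meanDescendants ω i k :=
    fun k hk => by
      rw [hω.meanJumps_of_le n.cast_nonneg hk, Finset.sum_eq_zero fun i hi => ?_]
      exact meanDescendants_of_lt (by rw [Finset.mem_range] at hi; omega)
  rcases le_total (n : ℤ) k with hk | hk
  · exact habove k hk
  induction k, hk using Int.leInductionDown with
  | base => exact habove n le_rfl
  | pred k hk ih =>
    have himm : ∑ i ∈ Finset.range n, (if k - 1 = i then Pi.single 0 1 else 0 : Fin 3 → ℝ≥0∞) =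
        if 0 ≤ k - 1 then Pi.single 0 1 else 0 := by
      split_ifs with h0
      · obtain ⟨j, hj⟩ := Int.eq_ofNat_of_zero_le h0
        have hjn : j ∈ Finset.range n := Finset.mem_range.2 (by omega)
        simp [hj, hjn]
      · exact Finset.sum_eq_zero fun i _ => if_neg (by omega)
    rw [hω.meanJumps_of_lt n.cast_nonneg (by omega)]
    simp only [meanDescendants_eq_vecMul ω _ (k - 1)]
    rw [← Matrix.sum_vecMul, Finset.sum_add_distrib, himm, sub_add_cancel, ih]

lemma tsum_meanDescendants_dotProduct (ω : Env) (i : ℤ) :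
    ∑' k, meanDescendants ω i k ⬝ᵥ ![2, 1, 2] = ∑' k : Set.Iic i, ENNReal.ofReal
      ((Pi.single 0 1 : Fin 3 → ℝ) ⬝ᵥ (descProd ω i k *ᵥ ![2, 1, 2])) := by
  rw [tsum_subtype (Set.Iic i) fun k => ENNReal.ofReal
    ((Pi.single 0 1 : Fin 3 → ℝ) ⬝ᵥ (descProd ω i k *ᵥ ![2, 1, 2]))]
  refine tsum_congr fun k => ?_
  by_cases hk : k ≤ i
  · have hweights : (0 : Fin 3 → ℝ) ≤ ![2, 1, 2] := fun l => by fin_cases l <;> simp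
    rw [Set.indicator_of_mem (Set.mem_Iic.2 hk), single_one_dotProduct, Matrix.mulVec,
      ofReal_dotProduct (descProd_nonneg ω i k 0) hweights]
    congr 1
    · funext m
      exact if_pos hk
    · funext l
      fin_cases l <;> simp
  · rw [Set.indicator_of_notMem (by simpa using hk), meanDescendants_of_lt (not_le.1 hk),
      zero_dotProduct]

theorem Contracting.lintegral_hit_eq (hω : Contracting ω) {n : ℕ} (hn : 0 < n) :
    ∫⁻ X, (hit n X : ℝ≥0∞) ∂(quenched ω 0) =
      n + ∑ i ∈ Finset.range n, ∑' k : Set.Iic (i : ℤ), ENNReal.ofReal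
        ((Pi.single 0 1 : Fin 3 → ℝ) ⬝ᵥ (descProd ω i k *ᵥ ![2, 1, 2])) := by
  rw [hω.lintegral_hit (Int.natCast_pos.2 hn), Int.toNat_natCast]
  simp only [hω.meanJumps_eq_sum, sum_dotProduct, ← tsum_meanDescendants_dotProduct]
  rw [Summable.tsum_finsetSum fun _ _ => ENNReal.summable]

end MeanHittingTime

end RWRE21

end

theorem mainTheorem10_general
    (ν : Measure RWRE21.JumpLaw) [IsProbabilityMeasure ν]
    (hpos : ∀ l : Fin 3, ∀ᵐ p ∂ν, 0 < p.1 l) (hC2 : RWRE21.C2 ν) :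
    ∀ᵐ ω ∂(RWRE21.envLaw ν),
      (∀ i : ℤ, RWRE21.meanOffspring ω i = (RWRE21.A ω i).map ENNReal.ofReal) ∧
      (∀ n : ℕ, 1 ≤ n → ∀ i : ℤ, i < n → ∀ u : Fin 3 → ℕ,
        RWRE21.quenched ω 0 (RWRE21.levelEvent n (i + 1) u) ≠ 0 →
        ∀ m : Fin 3,
          ∫⁻ X, ((RWRE21.U n i X m : ℕ∞) : ℝ≥0∞)
              ∂((RWRE21.quenched ω 0)[|RWRE21.levelEvent n (i + 1) u]) =
            ENNReal.ofReal
              ((((fun l => (u l : ℝ)) + RWRE21.immigrant i) ᵥ* RWRE21.A ω i) m)) ∧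
      (∀ n : ℕ, 1 ≤ n →
        ∫⁻ X, ((RWRE21.hit n X : ℕ∞) : ℝ≥0∞) ∂(RWRE21.quenched ω 0) =
          (n : ℝ≥0∞) + ∑ i ∈ Finset.range n, ∑' k : Set.Iic (i : ℤ),
            ENNReal.ofReal
              ((Pi.single 0 1 : Fin 3 → ℝ) ⬝ᵥ
                (RWRE21.descProd ω (i : ℤ) (k : ℤ) *ᵥ ![2, 1, 2]))) := by
  filter_upwards [RWRE21.ae_contracting (hpos 2) hC2,
    RWRE21.ae_envLaw_forall (ae_all_iff.2 hpos)] with ω hω hωpos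
  exact ⟨hω.meanOffspring_eq hωpos,
    fun _ hn _ hi _ hu => hω.lintegral_U_cond_levelEvent (Int.natCast_pos.2 hn) hi hu,
    fun _ hn => hω.lintegral_hit_eq hn⟩

theorem mainTheorem10
    (ν : Measure RWRE21.JumpLaw) [IsProbabilityMeasure ν]
    (hC1 : RWRE21.C1 ν) (hC2 : RWRE21.C2 ν) :
    ∀ᵐ ω ∂(RWRE21.envLaw ν),
      (∀ i : ℤ, RWRE21.meanOffspring ω i = (RWRE21.A ω i).map ENNReal.ofReal) ∧
      (∀ n : ℕ, 1 ≤ n → ∀ i : ℤ, i < n → ∀ u : Fin 3 → ℕ,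
        RWRE21.quenched ω 0 (RWRE21.levelEvent n (i + 1) u) ≠ 0 →
        ∀ m : Fin 3,
          ∫⁻ X, ((RWRE21.U n i X m : ℕ∞) : ℝ≥0∞)
              ∂((RWRE21.quenched ω 0)[|RWRE21.levelEvent n (i + 1) u]) =
            ENNReal.ofReal
              ((((fun l => (u l : ℝ)) + RWRE21.immigrant i) ᵥ* RWRE21.A ω i) m)) ∧
      (∀ n : ℕ, 1 ≤ n →
        ∫⁻ X, ((RWRE21.hit n X : ℕ∞) : ℝ≥0∞) ∂(RWRE21.quenched ω 0) =
          (n : ℝ≥0∞) + ∑ i ∈ Finset.range n, ∑' k : Set.Iic (i : ℤ),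
            ENNReal.ofReal
              ((Pi.single 0 1 : Fin 3 → ℝ) ⬝ᵥ
                (RWRE21.descProd ω (i : ℤ) (k : ℤ) *ᵥ ![2, 1, 2]))) :=
  mainTheorem10_general ν (fun l => (hC1 l).1) hC2
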